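/- Let $R_k^{(\alpha,\beta)}(x)=P_k^{(\alpha,\beta)}(x)/P_k^{(\alpha,\beta)}(1)$, $k\in\mathbf N_0=\{0,1,2,\dots\}$, be the normalized Jacobi polynomials, where $P_k^{(\alpha,\beta)}$ is the Jacobi polynomial of degree $k$ and order $(\alpha,\beta)$. For a sequence $\{m_k\}_{k\ge 0}$ and $\nu\in\mathbf R$ let $$\Delta_2^\nu m_k=\sum_{j=0}^\infty A_j^{-\nu-1}\,m_{k+2j},\qquad A_j^{\mu}=\frac{\Gamma(j+\mu+1)}{\Gamma(j+1)\,\Gamma(\mu+1)}=\frac{(\mu+1)(\mu+2)\cdots(\mu+j)}{j!},$$ whenever the series converges (where $\mu+1$ is a pole of $\Gamma$, $A_j^\mu$ is given by the last expression). For $a\in\mathbf R$ let $[a]^*$ denote the greatest integer strictly smaller than $a$. **Lemma 4.5.** Let $\alpha>-1/2$ and $0<\nu<\alpha+1/2$. Then for all $k\in\mathbf N_0$ and $0<\theta<\pi/2$ the series defining $\Delta_2^\nu R_k^{(\alpha,\alpha)}(\cos\theta)$ converges absolutely, and there is a constant $C$, depending only on $\alpha$ and $\nu$, such that for all $k\in\mathbf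 N_0$ and all $0<\theta<\pi/2$: (a) $|\Delta_2^\nu R_k^{(\alpha,\alpha)}(\cos\theta)|\le C\,(\sin\theta)^\nu$; (b) $|\Delta_2^\nu R_k^{(\alpha,\alpha)}(\cos\theta)|\le C\,(\sin\theta)^{\nu-\alpha-1/2}(k+1)^{-\alpha-1/2}$, where in (b) it is additionally assumed that $\nu\ge[\alpha+1/2]^*$ if $\alpha>1/2$. -/

import Mathlib

open Polynomial

/-- The Jacobi polynomial `P_n^{(a,b)}`, by its explicit expansion at `x = 1`:
`P_n^{(a,b)}(x) = ∑_j (n+a+b+1)_j (a+j+1)_{n-j} / (j! (n-j)!) * ((x-1)/2)^j`,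
where `(z)_j = z (z+1) ⋯ (z+j-1)`. -/
noncomputable def jacobiP (a b : ℝ) (n : ℕ) : ℝ[X] :=
  ∑ j ∈ Finset.range (n + 1),
    C ((ascPochhammer ℝ j).eval ((n : ℝ) + a + b + 1) *
        (ascPochhammer ℝ (n - j)).eval (a + (j : ℝ) + 1) /
        ((j.factorial : ℝ) * ((n - j).factorial : ℝ))) *
      (C (1 / 2 : ℝ) * (X - 1)) ^ j

/-- The normalized Jacobi polynomial `R_n^{(a,b)}(x) = P_n^{(a,b)}(x) / P_n^{(a,b)}(1)`. -/
noncomputable def jacobiR (a b : ℝ) (n : ℕ) (x : ℝ) : ℝ :=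
  (jacobiP a b n).eval x / (jacobiP a b n).eval 1

/-- The coefficient `A_j^μ = Γ(j+μ+1) / (Γ(j+1) Γ(μ+1)) = (μ+1)(μ+2)⋯(μ+j) / j!`. The product form
also gives the value (the limit) where `μ + 1` is a pole of `Γ`; for the agreement with the
quotient of Gamma functions at all other `μ` see `cesaroA_eq_Gamma`. -/
noncomputable def cesaroA (μ : ℝ) (j : ℕ) : ℝ :=
  (ascPochhammer ℝ j).eval (μ + 1) / (j.factorial : ℝ)

theorem cesaroA_eq_Gamma (μ : ℝ) (hμ : ∀ m : ℕ, μ + 1 ≠ -(m : ℝ)) (j : ℕ) :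
    cesaroA μ j =
      Real.Gamma ((j : ℝ) + μ + 1) / (Real.Gamma ((j : ℝ) + 1) * Real.Gamma (μ + 1)) := by
  have h0 : Real.Gamma (μ + 1) ≠ 0 := Real.Gamma_ne_zero hμ
  have key : ∀ i : ℕ, Real.Gamma ((i : ℝ) + μ + 1) =
      (ascPochhammer ℝ i).eval (μ + 1) * Real.Gamma (μ + 1) := by
    intro i
    induction i with
    | zero => simp
    | succ i ih =>
      have hne : (i : ℝ) + μ + 1 ≠ 0 := fun h => hμ i (by linarith)
      rw [ascPochhammer_succ_eval]
      have : ((i + 1 : ℕ) : ℝ) + μ + 1 = ((i : ℝ) + μ + 1) + 1 := by push_cast; ring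
      rw [this, Real.Gamma_add_one hne, ih]
      ring
  rw [cesaroA, key j, Real.Gamma_nat_eq_factorial]
  field_simp

/-- The `j`-th term of the series that defines the fractional difference `Δ_κ^μ m_k`. -/
noncomputable def fracDiffTerm (κ : ℕ) (μ : ℝ) (m : ℕ → ℝ) (k j : ℕ) : ℝ :=
  cesaroA (-μ - 1) j * m (k + κ * j)

/-- The fractional difference `Δ_κ^μ m_k = ∑_{j ≥ 0} A_j^{-μ-1} m_{k+κj}` of order `μ` with
increment `κ`. It is meaningful where `fracDiffTerm κ μ m k` is summable. -/
noncomputable def fracDiff (κ : ℕ) (μ : ℝ) (m : ℕ → ℝ) (k : ℕ) : ℝ :=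
  ∑' j : ℕ, fracDiffTerm κ μ m k j

/-- `[a]^*`, the greatest integer (strictly) smaller than `a`. -/
noncomputable def greatestIntLT (a : ℝ) : ℤ := ⌈a⌉ - 1

theorem isGreatest_greatestIntLT (a : ℝ) :
    IsGreatest {n : ℤ | (n : ℝ) < a} (greatestIntLT a) := by
  constructor
  · have := Int.ceil_lt_add_one a
    change ((⌈a⌉ - 1 : ℤ) : ℝ) < a
    push_cast
    linarith
  · intro n hn
    have hn' : (n : ℝ) < a := hn
    have := Int.lt_ceil.2 hn'
    simp only [greatestIntLT]
    omega

/-! Put g = α - 1/2, c = cos θ, s = sin θ, e = c + is and e' = c - is. Gegenbauer's formula makes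
R_n(c) an average of z^n, where z runs over the chord from e' to e with the normalized weight
(x(1-x))^g (`jacobiR_mul_chordMoment_zero`). It holds because both sides satisfy one three-term
recurrence. Hence |R_n| ≤ 1, and absolute summability of the coefficients gives convergence. By the
binomial series the fractional difference is the average of z^k (1-z²)^ν
(`fracDiff_jacobiR_mul_integral`).

On the chord |1-z²| ≤ 4s, which is (a). When ks < 1, (b) follows from (a), since then s is at most
2/(k+1).

When ks ≥ 1, the weight equals, up to a constant of modulus (4s²)^(-g), the restriction to the chord
of (1-ze)^g (1-ze')^g, which is holomorphic in the disc (`exists_discKernel_chordPoint`). Cauchy's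
theorem replaces the chord by the two radii ending at e and e'
(`integral_chord_eq_sub_integral_radial`). There |z|^k decays like exp(-k(1-r)), one factor has
modulus (1-r)^g, and the others are controlled by powers of (1-r)+s. A Gamma integral then yields
s^(ν+g) k^(-g-1) (`integral_radial_le`), and dividing by s·(4s²)^g gives (b). -/

/-! ### Ultraspherical polynomials: expansion at 1 and three-term recurrence. -/

/-- The coefficient of `((x-1)/2)^j` in the normalized ultraspherical polynomial `R_n^{(a,a)}`. -/
noncomputable def jacobiRCoeff (a : ℝ) (n j : ℕ) : ℝ :=
  (n.choose j : ℝ) * (ascPochhammer ℝ j).eval ((n : ℝ) + (2 * a + 1)) /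
    (ascPochhammer ℝ j).eval (a + 1)

theorem ascPochhammer_eval_add (x : ℝ) (m n : ℕ) :
    (ascPochhammer ℝ (m + n)).eval x =
      (ascPochhammer ℝ m).eval x * (ascPochhammer ℝ n).eval (x + m) := by
  rw [← ascPochhammer_mul]
  simp

theorem jacobiP_eval_one (a b : ℝ) (n : ℕ) :
    (jacobiP a b n).eval 1 = (ascPochhammer ℝ n).eval (a + 1) / (n.factorial : ℝ) := by
  rw [jacobiP, eval_finsetSum, Finset.sum_range_succ']
  simp

theorem jacobiR_eq_sum (a : ℝ) (ha : -1 < a) (n : ℕ) (x : ℝ) :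
    jacobiR a a n x =
      ∑ j ∈ Finset.range (n + 1), jacobiRCoeff a n j * ((x - 1) / 2) ^ j := by
  rw [jacobiR, jacobiP_eval_one, jacobiP, eval_finsetSum, Finset.sum_div]
  refine Finset.sum_congr rfl fun j hj => ?_
  have hjn : j ≤ n := Nat.lt_succ_iff.1 (Finset.mem_range.1 hj)
  have h1 : (ascPochhammer ℝ n).eval (a + 1) = (ascPochhammer ℝ j).eval (a + 1) *
      (ascPochhammer ℝ (n - j)).eval (a + j + 1) := by
    conv_lhs => rw [← Nat.add_sub_cancel' hjn]
    rw [ascPochhammer_eval_add]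
    congr 2
    ring
  have hp : 0 < (ascPochhammer ℝ j).eval (a + 1) := ascPochhammer_pos _ _ (by linarith)
  have hq : 0 < (ascPochhammer ℝ (n - j)).eval (a + j + 1) :=
    ascPochhammer_pos _ _ (by have : (0 : ℝ) ≤ j := j.cast_nonneg; linarith)
  have hn : (n.factorial : ℝ) ≠ 0 := by positivity
  have hj' : (j.factorial : ℝ) ≠ 0 := by positivity
  have hnj : ((n - j).factorial : ℝ) ≠ 0 := by positivity
  rw [h1, jacobiRCoeff, Nat.cast_choose ℝ hjn]
  simp only [eval_mul, eval_C, eval_pow, eval_sub, eval_X, eval_one]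
  rw [show (1 / 2 * (x - 1) : ℝ) = (x - 1) / 2 by ring,
    show (n : ℝ) + a + a + 1 = n + (2 * a + 1) by ring]
  field_simp

theorem jacobiRCoeff_eq_zero (a : ℝ) {n j : ℕ} (h : n < j) : jacobiRCoeff a n j = 0 := by
  simp [jacobiRCoeff, Nat.choose_eq_zero_of_lt h]

/-- Padding with zero coefficients lets polynomials of different degrees be compared over a common
range. -/
theorem jacobiR_eq_sum_of_lt (a : ℝ) (ha : -1 < a) {n N : ℕ} (h : n < N) (x : ℝ) :
    jacobiR a a n x = ∑ j ∈ Finset.range N, jacobiRCoeff a n j * ((x - 1) / 2) ^ j := by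
  rw [jacobiR_eq_sum a ha]
  refine Finset.sum_subset (Finset.range_mono h) fun j _ hj => ?_
  rw [jacobiRCoeff_eq_zero a (by simpa using hj), zero_mul]

theorem jacobiRCoeff_zero_right (a : ℝ) (n : ℕ) : jacobiRCoeff a n 0 = 1 := by
  simp [jacobiRCoeff]

/-- This is the three-term recurrence read off at y^(i+1), with x = 1 + 2y; the term with index i
comes from the factor 2y. All coefficients are rational multiples of one binomial and one Pochhammer
quotient, so it reduces to a rational identity. -/
theorem jacobiRCoeff_recurrence (a : ℝ) (ha : -(1 / 2) < a) (m i : ℕ) :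
    ((m : ℝ) + 1 + (2 * a + 1)) * jacobiRCoeff a (m + 2) (i + 1) =
      (2 * (m + 1) + (2 * a + 1)) *
        (jacobiRCoeff a (m + 1) (i + 1) + 2 * jacobiRCoeff a (m + 1) i) -
      (m + 1) * jacobiRCoeff a m (i + 1) := by
  have hi0 : (0 : ℝ) ≤ i := i.cast_nonneg
  have hm0 : (0 : ℝ) ≤ m := m.cast_nonneg
  have hd : 0 < (ascPochhammer ℝ i).eval (a + 1) := ascPochhammer_pos _ _ (by linarith)
  have c1 : ((m + 1).choose (i + 1) : ℝ) * (i + 1) = (m + 1).choose i * (m + 1 - i) := by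
    rcases le_or_gt i (m + 1) with h | h
    · have := Nat.choose_succ_right_eq (m + 1) i
      have h2 : (((m + 1).choose (i + 1) * (i + 1) : ℕ) : ℝ) =
        (((m + 1).choose i * (m + 1 - i) : ℕ) : ℝ) := by rw [this]
      push_cast [Nat.cast_sub h] at h2
      exact h2
    · simp [Nat.choose_eq_zero_of_lt h, Nat.choose_eq_zero_of_lt (h.trans (Nat.lt_succ_self i))]
  have c2 : ((m + 2).choose (i + 1) : ℝ) * (i + 1) = (m + 2) * (m + 1).choose i := by
    have := Nat.add_one_mul_choose_eq (m + 1) i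
    have h2 : (((m + 1 + 1) * (m + 1).choose i : ℕ) : ℝ) =
        (((m + 1 + 1).choose (i + 1) * (i + 1) : ℕ) : ℝ) := by rw [this]
    push_cast at h2
    linarith
  have c3 : (m + 1 : ℝ) * (m.choose (i + 1)) = (m + 1).choose (i + 1) * (m - i) := by
    rcases le_or_gt (i + 1) (m + 1) with h | h
    · have := Nat.choose_mul_succ_eq m (i + 1)
      have h2 : ((m.choose (i + 1) * (m + 1) : ℕ) : ℝ) =
        (((m + 1).choose (i + 1) * (m + 1 - (i + 1)) : ℕ) : ℝ) := by rw [this]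
      rw [Nat.add_sub_add_right] at h2
      push_cast [Nat.cast_sub (Nat.le_of_succ_le_succ h)] at h2
      linarith
    · simp [Nat.choose_eq_zero_of_lt h, Nat.choose_eq_zero_of_lt ((Nat.lt_succ_self m).trans h)]
  have p1 : (ascPochhammer ℝ (i + 1)).eval ((m : ℝ) + 1 + (2 * a + 1)) =
      (ascPochhammer ℝ i).eval ((m : ℝ) + 1 + (2 * a + 1)) * (m + 1 + (2 * a + 1) + i) :=
    ascPochhammer_succ_eval _ _
  have p2 : (ascPochhammer ℝ (i + 1)).eval ((m : ℝ) + (2 * a + 1)) =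
      (m + (2 * a + 1)) * (ascPochhammer ℝ i).eval ((m : ℝ) + 1 + (2 * a + 1)) := by
    rw [add_comm i 1, ascPochhammer_eval_add]
    simp only [ascPochhammer_one, eval_X, Nat.cast_one]
    congr 2
    ring
  have p3 : (m + 1 + (2 * a + 1)) * (ascPochhammer ℝ (i + 1)).eval ((m : ℝ) + 2 + (2 * a + 1)) =
      (ascPochhammer ℝ i).eval ((m : ℝ) + 1 + (2 * a + 1)) * (m + 1 + (2 * a + 1) + i) *
        (m + 2 + (2 * a + 1) + i) := by
    have h := ascPochhammer_eval_add ((m : ℝ) + 1 + (2 * a + 1)) 1 (i + 1)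
    rw [add_comm 1 (i + 1), ascPochhammer_succ_eval, p1] at h
    simp only [ascPochhammer_one, eval_X, Nat.cast_one, Nat.cast_add] at h
    rw [show (m : ℝ) + 2 + (2 * a + 1) = m + 1 + (2 * a + 1) + 1 by ring, ← h]
    ring
  have p4 := ascPochhammer_succ_eval i (a + 1)
  have hi1 : (i : ℝ) + 1 ≠ 0 := by positivity
  have hai : a + 1 + i ≠ 0 := by linarith
  simp only [jacobiRCoeff]
  push_cast
  rw [p4, p1, p2]
  generalize (ascPochhammer ℝ (i + 1)).eval ((m : ℝ) + 2 + (2 * a + 1)) = X at *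
  generalize (ascPochhammer ℝ i).eval ((m : ℝ) + 1 + (2 * a + 1)) = P at *
  generalize (ascPochhammer ℝ i).eval (a + 1) = D at *
  have e1 : ((m + 1).choose (i + 1) : ℝ) = (m + 1).choose i * (m + 1 - i) / (i + 1) := by
    rw [← c1]; field_simp
  have e2 : ((m + 2).choose (i + 1) : ℝ) = (m + 2) * (m + 1).choose i / (i + 1) := by
    rw [← c2]; field_simp
  have hm1 : (m : ℝ) + 1 ≠ 0 := by positivity
  have e3 : (m.choose (i + 1) : ℝ) = (m + 1).choose i * (m + 1 - i) / (i + 1) * (m - i) / (m + 1) := by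
    rw [← e1, ← c3]; field_simp
  have hmb : (m : ℝ) + 1 + (2 * a + 1) ≠ 0 := by linarith
  have e4 : X = P * (m + 1 + (2 * a + 1) + i) * (m + 2 + (2 * a + 1) + i) /
      (m + 1 + (2 * a + 1)) := by
    rw [← p3]; field_simp
  rw [e1, e2, e3, e4]
  have hD := hd.ne'
  field_simp
  ring

theorem jacobiR_zero (a x : ℝ) (ha : -1 < a) : jacobiR a a 0 x = 1 := by
  simp [jacobiR_eq_sum a ha, jacobiRCoeff_zero_right]

theorem jacobiR_one (a x : ℝ) (ha : -1 < a) : jacobiR a a 1 x = x := by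
  have : a + 1 ≠ 0 := by linarith
  simp only [jacobiR_eq_sum a ha, Finset.sum_range_succ, Finset.sum_range_zero,
    jacobiRCoeff_zero_right]
  simp [jacobiRCoeff]
  field_simp
  ring

theorem jacobiR_recurrence (a x : ℝ) (ha : -(1 / 2) < a) (m : ℕ) :
    ((m : ℝ) + 1 + (2 * a + 1)) * jacobiR a a (m + 2) x =
      (2 * (m + 1) + (2 * a + 1)) * x * jacobiR a a (m + 1) x -
      (m + 1) * jacobiR a a m x := by
  have ha' : -1 < a := by linarith
  set y := (x - 1) / 2 with hy
  have hx : x = 1 + 2 * y := by rw [hy]; ring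
  have h2 := jacobiR_eq_sum_of_lt a ha' (show m + 2 < m + 3 + 1 by omega) x
  have h1 := jacobiR_eq_sum_of_lt a ha' (show m + 1 < m + 3 + 1 by omega) x
  -- A second, shorter expansion of the same polynomial: multiplied by 2y, its powers shift to
  -- y^(i+1) and line up with the other sums after their constant terms are split off.
  have h1' := jacobiR_eq_sum_of_lt a ha' (show m + 1 < m + 3 by omega) x
  have h0 := jacobiR_eq_sum_of_lt a ha' (show m < m + 3 + 1 by omega) x
  rw [Finset.sum_range_succ', jacobiRCoeff_zero_right] at h2 h1 h0
  have key : (2 * ((m : ℝ) + 1) + (2 * a + 1)) * x * jacobiR a a (m + 1) x =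
      (2 * ((m : ℝ) + 1) + (2 * a + 1)) * (jacobiR a a (m + 1) x +
        2 * y * jacobiR a a (m + 1) x) := by
    rw [hx]; ring
  rw [key]
  nth_rw 2 [h1']
  rw [h1, h2, h0, ← hy]
  have := Finset.sum_congr (rfl : Finset.range (m + 3) = Finset.range (m + 3))
    (fun i _ => congrArg (· * y ^ (i + 1)) (jacobiRCoeff_recurrence a ha m i))
  have hL : ∑ i ∈ Finset.range (m + 3), ((m : ℝ) + 1 + (2 * a + 1)) *
      jacobiRCoeff a (m + 2) (i + 1) * y ^ (i + 1) = ((m : ℝ) + 1 + (2 * a + 1)) *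
      ∑ i ∈ Finset.range (m + 3), jacobiRCoeff a (m + 2) (i + 1) * y ^ (i + 1) := by
    rw [Finset.mul_sum]
    exact Finset.sum_congr rfl fun i _ => by ring
  have hR : ∑ i ∈ Finset.range (m + 3), ((2 * ((m : ℝ) + 1) + (2 * a + 1)) *
        (jacobiRCoeff a (m + 1) (i + 1) + 2 * jacobiRCoeff a (m + 1) i) -
      (m + 1) * jacobiRCoeff a m (i + 1)) * y ^ (i + 1) =
      (2 * ((m : ℝ) + 1) + (2 * a + 1)) *
        (∑ i ∈ Finset.range (m + 3), jacobiRCoeff a (m + 1) (i + 1) * y ^ (i + 1) +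
          2 * y * ∑ i ∈ Finset.range (m + 3), jacobiRCoeff a (m + 1) i * y ^ i) -
      (m + 1) * ∑ i ∈ Finset.range (m + 3), jacobiRCoeff a m (i + 1) * y ^ (i + 1) := by
    simp only [Finset.mul_sum, ← Finset.sum_add_distrib, ← Finset.sum_sub_distrib]
    exact Finset.sum_congr rfl fun i _ => by ring
  rw [hL, hR] at this
  linear_combination this

/-! ### The coefficients A_j: absolute summability and the binomial series. -/

theorem cesaroA_succ (μ : ℝ) (j : ℕ) :
    ((j : ℝ) + 1) * cesaroA μ (j + 1) = (μ + 1 + j) * cesaroA μ j := by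
  rw [cesaroA, cesaroA, ascPochhammer_succ_eval, Nat.factorial_succ]
  push_cast
  have : (j.factorial : ℝ) ≠ 0 := by positivity
  field_simp

/-- For j ≥ ν the ratio recurrence reads (j+1)|A_{j+1}| = (j-ν)|A_j|, so ν|A_j| telescopes and the
partial sums stay below N|A_N|. -/
theorem summable_abs_cesaroA (ν : ℝ) (hν : 0 < ν) : Summable fun j => |cesaroA (-ν - 1) j| := by
  obtain ⟨N, hN⟩ := exists_nat_ge ν
  rw [← summable_nat_add_iff N]
  have step (j : ℕ) : ν * |cesaroA (-ν - 1) (j + N)| =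
      ((j + N : ℕ) : ℝ) * |cesaroA (-ν - 1) (j + N)| -
      ((j + N + 1 : ℕ) : ℝ) * |cesaroA (-ν - 1) (j + N + 1)| := by
    have h := congrArg abs (cesaroA_succ (-ν - 1) (j + N))
    have hj : (0 : ℝ) ≤ j := j.cast_nonneg
    rw [abs_mul, abs_mul, abs_of_nonneg (show (0 : ℝ) ≤ ((j + N : ℕ) : ℝ) + 1 by positivity),
      abs_of_nonneg (a := -ν - 1 + 1 + ((j + N : ℕ) : ℝ)) (by push_cast; linarith)] at h
    push_cast at h ⊢
    linarith
  refine summable_of_sum_range_le (c := (N : ℝ) * |cesaroA (-ν - 1) N| / ν)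
    (fun _ => abs_nonneg _) fun n => ?_
  rw [le_div_iff₀ hν, mul_comm, Finset.mul_sum, Finset.sum_congr rfl fun j _ => step j]
  have := Finset.sum_range_sub' (fun j => ((j + N : ℕ) : ℝ) * |cesaroA (-ν - 1) (j + N)|) n
  simp only [add_right_comm _ N 1] at this ⊢
  simp only [add_right_comm _ 1 N] at this ⊢
  rw [this, Nat.zero_add]
  linarith [show 0 ≤ ((n + N : ℕ) : ℝ) * |cesaroA (-ν - 1) (n + N)| by positivity]

theorem hasSum_cesaroA_mul_pow (ν : ℝ) {u : ℂ} (hu : ‖u‖ < 1) :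
    HasSum (fun j => (cesaroA (-ν - 1) j : ℂ) * u ^ j) ((1 - u) ^ (ν : ℂ)) := by
  have h := (Complex.one_div_one_sub_cpow_hasFPowerSeriesOnBall_zero (-(ν : ℂ))).hasSum
    (y := u) (by simpa [Metric.mem_eball, edist_zero_right, enorm_eq_nnnorm, ← NNReal.coe_lt_coe] using hu)
  simp only [zero_add, Complex.cpow_neg, one_div, inv_inv] at h
  convert! h using 2 with j
  rw [FormalMultilinearSeries.ofScalars_apply_eq]
  rw [← Ring.multichoose_eq]
  have h1 := Ring.factorial_nsmul_multichoose_eq_ascPochhammer (-(ν : ℝ)) j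
  rw [Polynomial.ascPochhammer_smeval_eq_eval] at h1
  have h2 : cesaroA (-ν - 1) j = Ring.multichoose (-ν) j := by
    rw [cesaroA, sub_add_cancel, ← h1, nsmul_eq_mul]
    have : (j.factorial : ℝ) ≠ 0 := by positivity
    field_simp
  rw [h2, smul_eq_mul]
  congr 1
  have := Ring.map_multichoose (algebraMap ℝ ℂ) (-ν) j
  simpa using this

/-! ### The chord of the unit circle and its weight. -/

open MeasureTheory Set Filter Topology in
theorem intervalIntegrable_rpow_mul_one_sub (g : ℝ) (hg : -1 < g) :
    IntervalIntegrable (fun x : ℝ => (x * (1 - x)) ^ g) volume 0 1 := by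
  have h := (Complex.betaIntegral_convergent (u := ((g + 1 : ℝ) : ℂ)) (v := ((g + 1 : ℝ) : ℂ))
    (by simp; linarith) (by simp; linarith)).norm
  refine h.congr fun x hx => ?_
  rw [uIoc_of_le zero_le_one] at hx
  have h1 : (1 - (x : ℂ)) = ((1 - x : ℝ) : ℂ) := by push_cast; rfl
  have h2 : (((g + 1 : ℝ) : ℂ) - 1) = (g : ℂ) := by push_cast; ring
  simp only [h1, h2, norm_mul, Complex.norm_cpow_real, Complex.norm_real, Real.norm_eq_abs]
  rw [abs_of_pos hx.1, abs_of_nonneg (sub_nonneg.2 hx.2),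
    Real.mul_rpow hx.1.le (sub_nonneg.2 hx.2)]

/-- The point `c + i s (2x - 1)`; for `c = cos θ`, `s = sin θ` it runs over the chord of the unit
circle from `e^{-iθ}` to `e^{iθ}` as `x` runs over `[0, 1]`. -/
noncomputable def chordPoint (c s x : ℝ) : ℂ := c + s * (2 * x - 1) * Complex.I

@[fun_prop]
theorem continuous_chordPoint (c s : ℝ) : Continuous (chordPoint c s) := by
  unfold chordPoint
  fun_prop

theorem hasDerivAt_chordPoint (c s x : ℝ) :
    HasDerivAt (chordPoint c s) (2 * s * Complex.I) x := by
  have h := (((((hasDerivAt_id x).ofReal_comp.const_mul (2 : ℂ)).sub_const 1).const_mul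
    (s : ℂ)).mul_const Complex.I).const_add (c : ℂ)
  unfold chordPoint
  convert! h using 1
  simp
  ring

theorem normSq_chordPoint {c s : ℝ} (h : c ^ 2 + s ^ 2 = 1) (x : ℝ) :
    ‖chordPoint c s x‖ ^ 2 = 1 - 4 * s ^ 2 * (x * (1 - x)) := by
  have : chordPoint c s x = ⟨c, s * (2 * x - 1)⟩ := by
    apply Complex.ext <;> simp [chordPoint]
  rw [Complex.sq_norm, this, Complex.normSq_mk]
  linear_combination h

theorem norm_chordPoint_le_one {c s x : ℝ} (h : c ^ 2 + s ^ 2 = 1) (hx : x ∈ Set.Icc (0 : ℝ) 1) :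
    ‖chordPoint c s x‖ ≤ 1 := by
  rw [← sq_le_one_iff₀ (norm_nonneg _), normSq_chordPoint h]
  have := mul_nonneg hx.1 (sub_nonneg.2 hx.2)
  nlinarith [mul_nonneg (sq_nonneg s) this]

theorem norm_chordPoint_lt_one {c s x : ℝ} (h : c ^ 2 + s ^ 2 = 1) (hs : 0 < s)
    (hx : x ∈ Set.Ioo (0 : ℝ) 1) : ‖chordPoint c s x‖ < 1 := by
  rw [← sq_lt_one_iff₀ (norm_nonneg _), normSq_chordPoint h]
  have := mul_pos hx.1 (sub_pos.2 hx.2)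
  nlinarith [mul_pos (pow_pos hs 2) this]

/-- The quadratic has roots e and e', the endpoints of the chord, so on the chord it is a multiple
of x(1-x). This turns a raised power of the weight back into a polynomial in z. -/
theorem chordPoint_quadratic {c s : ℝ} (h : c ^ 2 + s ^ 2 = 1) (x : ℝ) :
    chordPoint c s x ^ 2 - 2 * c * chordPoint c s x + 1 = 4 * s ^ 2 * (x * (1 - x)) := by
  have h' : (c : ℂ) ^ 2 + s ^ 2 = 1 := by exact_mod_cast h
  unfold chordPoint
  linear_combination (-(1 : ℂ)) * h' + ((s : ℂ) * (2 * x - 1)) ^ 2 * Complex.I_sq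

/-! ### Moments on the chord and Gegenbauer's representation. -/

/-- The moments of the chord point with respect to the weight `(x(1-x))^g`. -/
noncomputable def chordMoment (g c s : ℝ) (n : ℕ) : ℂ :=
  ∫ x in (0 : ℝ)..1, chordPoint c s x ^ n * (((x * (1 - x)) ^ g : ℝ) : ℂ)

open MeasureTheory Set in
theorem intervalIntegrable_continuous_mul_weight {g : ℝ} (hg : -1 < g) {f : ℝ → ℂ}
    (hf : Continuous f) :
    IntervalIntegrable (fun x : ℝ => f x * (((x * (1 - x)) ^ g : ℝ) : ℂ)) volume 0 1 :=
  IntervalIntegrable.continuousOn_mul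
    ⟨(intervalIntegrable_rpow_mul_one_sub g hg).1.ofReal,
      (intervalIntegrable_rpow_mul_one_sub g hg).2.ofReal⟩
    hf.continuousOn

-- The integrand is the derivative of -2is z^n (x(1-x))^(g+1), which vanishes at both ends because g
-- + 1 > 0. For n = 0 the truncated exponent n - 1 is harmless, being multiplied by n.
open MeasureTheory Set in
theorem integral_chordPoint_deriv_eq_zero {g c s : ℝ} (hg : -1 < g) (h : c ^ 2 + s ^ 2 = 1)
    (n : ℕ) :
    ∫ x in (0 : ℝ)..1, (n * chordPoint c s x ^ (n - 1) *
      (chordPoint c s x ^ 2 - 2 * c * chordPoint c s x + 1) +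
      2 * (g + 1) * chordPoint c s x ^ n * (chordPoint c s x - c)) *
        (((x * (1 - x)) ^ g : ℝ) : ℂ) = 0 := by
  set f : ℝ → ℂ := fun x => -(2 * s * Complex.I) *
    (chordPoint c s x ^ n * (((x * (1 - x)) ^ (g + 1) : ℝ) : ℂ)) with hf
  have key := intervalIntegral.integral_eq_sub_of_hasDerivAt_of_le (a := 0) (b := 1) (f := f)
    (f' := fun x => (n * chordPoint c s x ^ (n - 1) *
      (chordPoint c s x ^ 2 - 2 * c * chordPoint c s x + 1) +
      2 * (g + 1) * chordPoint c s x ^ n * (chordPoint c s x - c)) *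
        (((x * (1 - x)) ^ g : ℝ) : ℂ)) zero_le_one ?_ ?_
    (intervalIntegrable_continuous_mul_weight hg (by fun_prop))
  · have hg' : g + 1 ≠ 0 := by linarith
    simpa [hf, Real.zero_rpow hg'] using key
  · have : Continuous fun x : ℝ => (x * (1 - x)) ^ (g + 1) :=
      (by fun_prop : Continuous fun x : ℝ => x * (1 - x)).rpow_const fun _ => Or.inr (by linarith)
    exact (continuous_const.mul (((continuous_chordPoint c s).pow n).mul
      (Complex.continuous_ofReal.comp this))).continuousOn
  · intro x hx
    have hx0 : 0 < x * (1 - x) := mul_pos hx.1 (sub_pos.2 hx.2)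
    have d1 : HasDerivAt (fun x : ℝ => x * (1 - x)) (1 - 2 * x) x := by
      have := (hasDerivAt_id x).mul ((hasDerivAt_id x).const_sub 1)
      convert! this using 1
      simp
      ring
    have d2 := (d1.rpow_const (p := g + 1) (Or.inl hx0.ne')).ofReal_comp
    have d3 := (((hasDerivAt_chordPoint c s x).pow n).mul d2).const_mul (-(2 * s * Complex.I))
    convert! d3 using 1
    rw [chordPoint_quadratic h, Pi.pow_apply, Real.rpow_add_one hx0.ne', add_sub_cancel_right]
    push_cast
    generalize (((x * (1 - x)) ^ g : ℝ) : ℂ) = w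
    have hz : chordPoint c s x - c = s * (2 * x - 1) * Complex.I := by simp [chordPoint]
    rw [hz]
    have := Complex.I_sq
    linear_combination (4 * (s : ℂ) ^ 2 * (x * (1 - x)) * n * chordPoint c s x ^ (n - 1) * w) * this

theorem chordMoment_one {g c s : ℝ} (hg : -1 < g) (h : c ^ 2 + s ^ 2 = 1) :
    chordMoment g c s 1 = c * chordMoment g c s 0 := by
  have key := integral_chordPoint_deriv_eq_zero hg h 0
  have hg' : (2 * ((g : ℂ) + 1)) ≠ 0 := by
    have : (2 * (g + 1) : ℝ) ≠ 0 := by linarith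
    exact_mod_cast this
  have e : ∀ x : ℝ, (((0 : ℕ) : ℂ) * chordPoint c s x ^ (0 - 1) *
      (chordPoint c s x ^ 2 - 2 * c * chordPoint c s x + 1) +
      2 * (g + 1) * chordPoint c s x ^ 0 * (chordPoint c s x - c)) *
        (((x * (1 - x)) ^ g : ℝ) : ℂ) = (2 * ((g : ℂ) + 1)) *
      (chordPoint c s x ^ 1 * (((x * (1 - x)) ^ g : ℝ) : ℂ) -
        c * (chordPoint c s x ^ 0 * (((x * (1 - x)) ^ g : ℝ) : ℂ))) := by
    intro x; push_cast; ring
  simp only [e] at key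
  rw [intervalIntegral.integral_const_mul, intervalIntegral.integral_sub,
    intervalIntegral.integral_const_mul] at key
  · have := (mul_eq_zero.1 key).resolve_left hg'
    exact sub_eq_zero.1 this
  · exact intervalIntegrable_continuous_mul_weight hg (by fun_prop)
  · exact (intervalIntegrable_continuous_mul_weight hg (by fun_prop)).const_mul _

theorem chordMoment_recurrence {g c s : ℝ} (hg : -1 < g) (h : c ^ 2 + s ^ 2 = 1) (m : ℕ) :
    ((m : ℂ) + 1 + 2 * (g + 1)) * chordMoment g c s (m + 2) =
      (2 * (m + 1) + 2 * (g + 1)) * c * chordMoment g c s (m + 1) -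
      (m + 1) * chordMoment g c s m := by
  have key := integral_chordPoint_deriv_eq_zero hg h (m + 1)
  have e : ∀ x : ℝ, (((m + 1 : ℕ) : ℂ) * chordPoint c s x ^ (m + 1 - 1) *
      (chordPoint c s x ^ 2 - 2 * c * chordPoint c s x + 1) +
      2 * (g + 1) * chordPoint c s x ^ (m + 1) * (chordPoint c s x - c)) *
        (((x * (1 - x)) ^ g : ℝ) : ℂ) =
      ((m : ℂ) + 1 + 2 * (g + 1)) * (chordPoint c s x ^ (m + 2) * (((x * (1 - x)) ^ g : ℝ) : ℂ)) -
      (2 * (m + 1) + 2 * (g + 1)) * c *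
        (chordPoint c s x ^ (m + 1) * (((x * (1 - x)) ^ g : ℝ) : ℂ)) +
      (m + 1) * (chordPoint c s x ^ m * (((x * (1 - x)) ^ g : ℝ) : ℂ)) := by
    intro x
    rw [Nat.add_sub_cancel]
    push_cast
    ring
  have hi (n : ℕ) := intervalIntegrable_continuous_mul_weight hg
    ((continuous_chordPoint c s).pow n)
  simp only [e] at key
  rw [intervalIntegral.integral_add, intervalIntegral.integral_sub,
    intervalIntegral.integral_const_mul, intervalIntegral.integral_const_mul,
    intervalIntegral.integral_const_mul] at key
  · unfold chordMoment
    linear_combination key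
  · exact (hi _).const_mul _
  · exact (hi _).const_mul _
  · exact ((hi _).const_mul _).sub ((hi _).const_mul _)
  · exact (hi _).const_mul _

/-- Gegenbauer's integral representation of the ultraspherical polynomials. -/
theorem jacobiR_mul_chordMoment_zero {a c s : ℝ} (ha : -(1 / 2) < a) (h : c ^ 2 + s ^ 2 = 1)
    (n : ℕ) :
    (jacobiR a a n c : ℂ) * chordMoment (a - 1 / 2) c s 0 = chordMoment (a - 1 / 2) c s n := by
  have hg : -1 < a - 1 / 2 := by linarith
  induction n using Nat.twoStepInduction with
  | zero => simp [jacobiR_zero a c (by linarith)]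
  | one => rw [jacobiR_one a c (by linarith), chordMoment_one hg h]
  | more m ih0 ih1 =>
    -- With g = a - 1/2 one has 2(g+1) = 2a+1, so moments and polynomials obey the same recurrence.
    have r1 := chordMoment_recurrence hg h m
    have r2 : (((m : ℝ) + 1 + (2 * a + 1) : ℝ) : ℂ) * jacobiR a a (m + 2) c =
      ((2 * (m + 1) + (2 * a + 1)) * c * jacobiR a a (m + 1) c - (m + 1) * jacobiR a a m c : ℝ) := by
      rw [← jacobiR_recurrence a c ha m]; push_cast; rfl
    have hne : (((m : ℝ) + 1 + (2 * a + 1) : ℝ) : ℂ) ≠ 0 := by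
      have : (0 : ℝ) ≤ m := m.cast_nonneg
      exact_mod_cast (by linarith : (m : ℝ) + 1 + (2 * a + 1) ≠ 0)
    refine mul_left_cancel₀ hne ?_
    push_cast at r1 r2 ⊢
    rw [← ih0, ← ih1] at r1
    linear_combination chordMoment (a - 1 / 2) c s 0 * r2 - r1

theorem chordMoment_zero (g c s : ℝ) :
    chordMoment g c s 0 = ((∫ x in (0 : ℝ)..1, (x * (1 - x)) ^ g : ℝ) : ℂ) := by
  simp only [chordMoment, pow_zero, one_mul]
  exact intervalIntegral.integral_ofReal

theorem integral_rpow_mul_one_sub_pos {g : ℝ} (hg : -1 < g) :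
    0 < ∫ x in (0 : ℝ)..1, (x * (1 - x)) ^ g :=
  intervalIntegral.intervalIntegral_pos_of_pos_on (intervalIntegrable_rpow_mul_one_sub g hg)
    (fun _ hx => Real.rpow_pos_of_pos (mul_pos hx.1 (sub_pos.2 hx.2)) _) zero_lt_one

open MeasureTheory Set in
theorem norm_integral_mul_weight_le {g M : ℝ} (hg : -1 < g) {f : ℝ → ℂ}
    (hf : ∀ x ∈ Ioo (0 : ℝ) 1, ‖f x‖ ≤ M) :
    ‖∫ x in (0 : ℝ)..1, f x * (((x * (1 - x)) ^ g : ℝ) : ℂ)‖ ≤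
      M * ∫ x in (0 : ℝ)..1, (x * (1 - x)) ^ g := by
  rw [← intervalIntegral.integral_const_mul]
  refine intervalIntegral.norm_integral_le_of_norm_le zero_le_one ?_
    ((intervalIntegrable_rpow_mul_one_sub g hg).const_mul M)
  -- The half-open interval already omits 0; dropping the null point 1 leaves the open interval.
  have h1 : ∀ᵐ x : ℝ, x ≠ 1 := by simp [ae_iff]
  filter_upwards [h1] with x hx1 hx
  have hx' : x ∈ Ioo (0 : ℝ) 1 := ⟨hx.1, lt_of_le_of_ne hx.2 hx1⟩
  have : 0 ≤ (x * (1 - x)) ^ g :=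
    Real.rpow_nonneg (mul_nonneg hx.1.le (sub_nonneg.2 hx.2)) _
  rw [norm_mul, Complex.norm_real, Real.norm_eq_abs, abs_of_nonneg this]
  exact mul_le_mul_of_nonneg_right (hf x hx') this

theorem abs_jacobiR_le_one {a c s : ℝ} (ha : -(1 / 2) < a) (h : c ^ 2 + s ^ 2 = 1) (n : ℕ) :
    |jacobiR a a n c| ≤ 1 := by
  have hg : -1 < a - 1 / 2 := by linarith
  have hpos := integral_rpow_mul_one_sub_pos hg
  have h1 := congrArg norm (jacobiR_mul_chordMoment_zero ha h n)
  rw [chordMoment_zero, norm_mul, Complex.norm_real, Complex.norm_real, Real.norm_eq_abs,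
    Real.norm_eq_abs, abs_of_pos hpos] at h1
  refine le_of_mul_le_mul_right ?_ hpos
  rw [h1]
  refine norm_integral_mul_weight_le hg fun x hx => ?_
  rw [norm_pow]
  exact pow_le_one₀ (norm_nonneg _) (norm_chordPoint_le_one h ⟨hx.1.le, hx.2.le⟩)

/-! ### The fractional difference as a chord integral, and the bound (a). -/

theorem summable_fracDiffTerm_jacobiR {a c s ν : ℝ} (ha : -(1 / 2) < a) (hν : 0 < ν)
    (h : c ^ 2 + s ^ 2 = 1) (k : ℕ) :
    Summable (fracDiffTerm 2 ν (fun n => jacobiR a a n c) k) := by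
  refine Summable.of_norm_bounded (summable_abs_cesaroA ν hν) fun j => ?_
  rw [fracDiffTerm, Real.norm_eq_abs, abs_mul]
  exact mul_le_of_le_one_right (abs_nonneg _) (abs_jacobiR_le_one ha h _)

-- Sum and integral are interchanged by dominated convergence with majorant |A_j| times the weight.
-- Inside the chord |z| < 1, so the binomial series at z² applies.
open MeasureTheory Set in
theorem fracDiff_jacobiR_mul_integral {a c s ν : ℝ} (ha : -(1 / 2) < a) (hν : 0 < ν)
    (h : c ^ 2 + s ^ 2 = 1) (hs : 0 < s) (k : ℕ) :
    (fracDiff 2 ν (fun n => jacobiR a a n c) k : ℂ) * chordMoment (a - 1 / 2) c s 0 =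
      ∫ x in (0 : ℝ)..1, (chordPoint c s x ^ k * (1 - chordPoint c s x ^ 2) ^ (ν : ℂ)) *
        (((x * (1 - x)) ^ (a - 1 / 2) : ℝ) : ℂ) := by
  have hg : -1 < a - 1 / 2 := by linarith
  have h1 := (Complex.hasSum_ofReal.2 (summable_fracDiffTerm_jacobiR ha hν h k).hasSum).mul_right
    (chordMoment (a - 1 / 2) c s 0)
  refine h1.unique ?_
  set w : ℝ → ℂ := fun x => (((x * (1 - x)) ^ (a - 1 / 2) : ℝ) : ℂ) with hw
  have hwi : IntervalIntegrable w volume 0 1 :=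
    ⟨(intervalIntegrable_rpow_mul_one_sub _ hg).1.ofReal,
      (intervalIntegrable_rpow_mul_one_sub _ hg).2.ofReal⟩
  have hx1 : ∀ᵐ x : ℝ, x ≠ 1 := by simp [ae_iff]
  have h2 : HasSum (fun j : ℕ => ∫ x in (0 : ℝ)..1, (cesaroA (-ν - 1) j : ℂ) *
        (chordPoint c s x ^ (k + 2 * j) * w x))
      (∫ x in (0 : ℝ)..1, (chordPoint c s x ^ k * (1 - chordPoint c s x ^ 2) ^ (ν : ℂ)) * w x) := by
    refine intervalIntegral.hasSum_integral_of_dominated_convergence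
      (fun j x => |cesaroA (-ν - 1) j| * ‖w x‖) (fun j => ?_) (fun j => ?_) ?_ ?_ ?_
    · have := (intervalIntegrable_continuous_mul_weight hg
        ((continuous_chordPoint c s).pow (k + 2 * j))).const_mul (cesaroA (-ν - 1) j : ℂ)
      exact (intervalIntegrable_iff.1 this).aestronglyMeasurable
    · refine Filter.Eventually.of_forall fun x hx => ?_
      rw [uIoc_of_le zero_le_one] at hx
      rw [norm_mul, norm_mul, norm_pow, Complex.norm_real, Real.norm_eq_abs]
      refine mul_le_mul_of_nonneg_left ?_ (abs_nonneg _)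
      exact mul_le_of_le_one_left (norm_nonneg _)
        (pow_le_one₀ (norm_nonneg _) (norm_chordPoint_le_one h ⟨hx.1.le, hx.2⟩))
    · exact Filter.Eventually.of_forall fun x _ => (summable_abs_cesaroA ν hν).mul_right _
    · simp only [tsum_mul_right]
      exact hwi.norm.const_mul _
    · filter_upwards [hx1] with x hx1 hx
      rw [uIoc_of_le zero_le_one] at hx
      have hlt := norm_chordPoint_lt_one h hs ⟨hx.1, lt_of_le_of_ne hx.2 hx1⟩
      have hsq : ‖chordPoint c s x ^ 2‖ < 1 := by
        rw [norm_pow]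
        exact pow_lt_one₀ (norm_nonneg _) hlt two_ne_zero
      have := (hasSum_cesaroA_mul_pow ν hsq).mul_left (chordPoint c s x ^ k * w x)
      convert! this using 1
      · ext j
        rw [pow_add, pow_mul]
        ring
      · ring
  convert! h2 using 2 with j
  rw [intervalIntegral.integral_const_mul, fracDiffTerm, Complex.ofReal_mul, mul_assoc,
    jacobiR_mul_chordMoment_zero ha h]
  rfl

/-- The explicit factor s is the source of the power of sin θ in (a). -/
theorem one_sub_chordPoint_sq {c s : ℝ} (h : c ^ 2 + s ^ 2 = 1) (x : ℝ) :
    1 - chordPoint c s x ^ 2 =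
      s * (s * (1 + (2 * x - 1) ^ 2) - 2 * c * (2 * x - 1) * Complex.I) := by
  have h' : (c : ℂ) ^ 2 + s ^ 2 = 1 := by exact_mod_cast h
  unfold chordPoint
  linear_combination (-(1 : ℂ)) * h' - ((s : ℂ) * (2 * x - 1)) ^ 2 * Complex.I_sq

theorem norm_one_sub_chordPoint_sq_le {c s x : ℝ} (h : c ^ 2 + s ^ 2 = 1) (hs : 0 < s)
    (hx : x ∈ Set.Icc (0 : ℝ) 1) : ‖1 - chordPoint c s x ^ 2‖ ≤ 4 * s := by
  have hs1 : s ≤ 1 := by nlinarith [sq_nonneg c]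
  have hc1 : |c| ≤ 1 := abs_le_one_iff_mul_self_le_one.2 (by nlinarith [sq_nonneg s])
  have ht : |2 * x - 1| ≤ 1 := abs_le.2 ⟨by linarith [hx.1], by linarith [hx.2]⟩
  have ht2 : (2 * x - 1) ^ 2 ≤ 1 := (sq_le_one_iff_abs_le_one _).2 ht
  rw [one_sub_chordPoint_sq h, norm_mul, Complex.norm_real, Real.norm_eq_abs, abs_of_pos hs,
    mul_comm]
  refine mul_le_mul_of_nonneg_right ((norm_sub_le _ _).trans ?_) hs.le
  have e1 : ‖(s : ℂ) * (1 + (2 * x - 1) ^ 2)‖ = s * (1 + (2 * x - 1) ^ 2) := by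
    rw [← abs_of_nonneg (show 0 ≤ s * (1 + (2 * x - 1) ^ 2) by positivity), ← Real.norm_eq_abs,
      ← Complex.norm_real]
    push_cast
    rfl
  have e2 : ‖2 * (c : ℂ) * (2 * x - 1) * Complex.I‖ = 2 * (|c| * |2 * x - 1|) := by
    rw [norm_mul, Complex.norm_I, mul_one, ← abs_mul, ← abs_two (α := ℝ), ← abs_mul, abs_two,
      ← Real.norm_eq_abs, ← Complex.norm_real]
    push_cast
    rw [mul_assoc]
  rw [e1, e2]
  nlinarith [mul_le_one₀ hc1 (abs_nonneg _) ht]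

theorem abs_fracDiff_jacobiR_le {a c s ν : ℝ} (ha : -(1 / 2) < a) (hν : 0 < ν)
    (h : c ^ 2 + s ^ 2 = 1) (hs : 0 < s) (k : ℕ) :
    |fracDiff 2 ν (fun n => jacobiR a a n c) k| ≤ 4 ^ ν * s ^ ν := by
  have hg : -1 < a - 1 / 2 := by linarith
  have hpos := integral_rpow_mul_one_sub_pos hg
  have h1 := congrArg norm (fracDiff_jacobiR_mul_integral ha hν h hs k)
  rw [chordMoment_zero, norm_mul, Complex.norm_real, Complex.norm_real, Real.norm_eq_abs,
    Real.norm_eq_abs, abs_of_pos hpos] at h1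
  refine le_of_mul_le_mul_right ?_ hpos
  rw [h1]
  refine norm_integral_mul_weight_le hg fun x hx => ?_
  have hx' : x ∈ Set.Icc (0 : ℝ) 1 := ⟨hx.1.le, hx.2.le⟩
  rw [norm_mul, norm_pow, Complex.norm_cpow_real, ← Real.mul_rpow (by norm_num) hs.le]
  exact (mul_le_of_le_one_left (Real.rpow_nonneg (norm_nonneg _) _)
    (pow_le_one₀ (norm_nonneg _) (norm_chordPoint_le_one h hx'))).trans
    (Real.rpow_le_rpow (norm_nonneg _) (norm_one_sub_chordPoint_sq_le h hs hx') hν.le)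

/-! ### The holomorphic kernel and its size on the radii. -/

/-- The holomorphic function on the unit disc whose integral along the chord from `e'` to `e` gives
the fractional difference of the ultraspherical polynomials. -/
noncomputable def discKernel (g ν : ℝ) (k : ℕ) (e e' z : ℂ) : ℂ :=
  z ^ k * (1 - z ^ 2) ^ (ν : ℂ) * ((1 - z * e) ^ (g : ℂ) * (1 - z * e') ^ (g : ℂ))

theorem discKernel_comm (g ν : ℝ) (k : ℕ) (e e' z : ℂ) :
    discKernel g ν k e e' z = discKernel g ν k e' e z := by
  rw [discKernel, discKernel, mul_comm ((1 - z * e) ^ (g : ℂ))]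

theorem one_sub_mem_slitPlane {w : ℂ} (hw : ‖w‖ < 1) : 1 - w ∈ Complex.slitPlane := by
  rw [sub_eq_add_neg]
  exact Complex.mem_slitPlane_of_norm_lt_one (by rwa [norm_neg])

theorem norm_discKernel (g ν : ℝ) (k : ℕ) (e e' z : ℂ) :
    ‖discKernel g ν k e e' z‖ =
      ‖z‖ ^ k * ‖1 - z ^ 2‖ ^ ν * (‖1 - z * e‖ ^ g * ‖1 - z * e'‖ ^ g) := by
  simp [discKernel, Complex.norm_cpow_real]

theorem differentiableOn_discKernel (g ν : ℝ) (k : ℕ) {e e' : ℂ} (he : ‖e‖ = 1)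
    (he' : ‖e'‖ = 1) : DifferentiableOn ℂ (discKernel g ν k e e') (Metric.ball 0 1) := by
  intro z hz
  rw [mem_ball_zero_iff] at hz
  have h0 : ‖z ^ 2‖ < 1 := by
    rw [norm_pow]; exact pow_lt_one₀ (norm_nonneg _) hz two_ne_zero
  have h1 : ‖z * e‖ < 1 := by rwa [norm_mul, he, mul_one]
  have h2 : ‖z * e'‖ < 1 := by rwa [norm_mul, he', mul_one]
  refine DifferentiableAt.differentiableWithinAt ?_
  unfold discKernel
  have d0 : DifferentiableAt ℂ (fun z : ℂ => (1 - z ^ 2) ^ (ν : ℂ)) z :=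
    DifferentiableAt.cpow_const (by fun_prop) (one_sub_mem_slitPlane h0)
  have d1 : DifferentiableAt ℂ (fun z : ℂ => (1 - z * e) ^ (g : ℂ)) z :=
    DifferentiableAt.cpow_const (by fun_prop) (one_sub_mem_slitPlane h1)
  have d2 : DifferentiableAt ℂ (fun z : ℂ => (1 - z * e') ^ (g : ℂ)) z :=
    DifferentiableAt.cpow_const (by fun_prop) (one_sub_mem_slitPlane h2)
  exact ((differentiableAt_id.pow k).mul d0).mul (d1.mul d2)

/-- Write 1 - w = (1 - ρw) - (1-ρ)w and note 1 - ρ ≤ |1 - ρw|. Thus radial shrinking at most halves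
the distance to 1, which controls negative powers. -/
theorem norm_one_sub_le_two_mul {w : ℂ} (hw : ‖w‖ ≤ 1) {ρ : ℝ} (hρ : ρ ∈ Set.Icc (0 : ℝ) 1) :
    ‖1 - w‖ ≤ 2 * ‖1 - ρ * w‖ := by
  have hn : ‖(ρ : ℂ) * w‖ ≤ ρ := by
    rw [norm_mul, Complex.norm_real, Real.norm_eq_abs, abs_of_nonneg hρ.1]
    exact mul_le_of_le_one_right hρ.1 hw
  have h1 : 1 - ρ ≤ ‖1 - ρ * w‖ := by
    have := norm_sub_norm_le (1 : ℂ) (ρ * w)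
    rw [norm_one] at this
    linarith
  have h2 : ‖((1 - ρ : ℝ) : ℂ) * w‖ ≤ 1 - ρ := by
    rw [norm_mul, Complex.norm_real, Real.norm_eq_abs, abs_of_nonneg (sub_nonneg.2 hρ.2)]
    exact mul_le_of_le_one_right (sub_nonneg.2 hρ.2) hw
  have h3 : 1 - w = (1 - ρ * w) - ((1 - ρ : ℝ) : ℂ) * w := by push_cast; ring
  calc ‖1 - w‖ = ‖(1 - ρ * w) - ((1 - ρ : ℝ) : ℂ) * w‖ := by rw [← h3]
    _ ≤ _ := norm_sub_le _ _
    _ ≤ _ := by linarith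

theorem rpow_le_two_rpow_abs_mul {u y g : ℝ} (hu : 0 < u) (h1 : u / 2 ≤ y) (h2 : y ≤ 2 * u) :
    y ^ g ≤ 2 ^ |g| * u ^ g := by
  rcases le_total 0 g with hg | hg
  · rw [abs_of_nonneg hg, ← Real.mul_rpow zero_le_two hu.le]
    exact Real.rpow_le_rpow (by linarith) h2 hg
  · rw [abs_of_nonpos hg, Real.rpow_neg zero_le_two, ← Real.inv_rpow zero_le_two,
      ← Real.mul_rpow (by norm_num) hu.le]
    exact Real.rpow_le_rpow_of_nonpos (by positivity) (by linarith) hg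

/-- Since ee' = 1, the factor 1 - ze' is exactly 1 - r on this radius. The modulus of 1 - ze is
comparable to u = (1-r)+s, two-sidedly because g may be negative; for 1 - z² an upper bound suffices
as ν ≥ 0. -/
theorem norm_discKernel_radial_le {g ν s r : ℝ} (hν : 0 ≤ ν) (hs : 0 < s) (k : ℕ) {e e' : ℂ}
    (he : ‖e‖ = 1) (hee : e * e' = 1) (hes : ‖1 - e ^ 2‖ = 2 * s) (hr0 : 0 ≤ r) (hr1 : r < 1) :
    ‖discKernel g ν k e e' (r * e)‖ ≤
      2 ^ ν * 2 ^ |g| * ((1 - r) ^ g * ((1 - r) + s) ^ (ν + g) * Real.exp (-(k * (1 - r)))) := by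
  have hr : 0 < 1 - r := sub_pos.2 hr1
  set u := 1 - r + s with hu
  have hu0 : 0 < u := by positivity
  have he2 : ‖e ^ 2‖ = 1 := by rw [norm_pow, he, one_pow]
  have n0 : ‖(r : ℂ) * e‖ = r := by
    rw [norm_mul, he, mul_one, Complex.norm_real, Real.norm_eq_abs, abs_of_nonneg hr0]
  have n1 : ‖1 - (r : ℂ) * e * e'‖ = 1 - r := by
    rw [mul_assoc, hee, mul_one, ← Complex.ofReal_one, ← Complex.ofReal_sub, Complex.norm_real,
      Real.norm_eq_abs, abs_of_pos hr]
  have upper {t : ℝ} (ht0 : 0 ≤ t) (ht1 : t ≤ 1) : ‖1 - (t : ℂ) * e ^ 2‖ ≤ (1 - t) + 2 * s := by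
    have h3 : 1 - (t : ℂ) * e ^ 2 = ((1 - t : ℝ) : ℂ) + (t : ℂ) * (1 - e ^ 2) := by
      push_cast; ring
    rw [h3]
    refine (norm_add_le _ _).trans ?_
    rw [norm_mul, Complex.norm_real, Complex.norm_real, Real.norm_eq_abs, Real.norm_eq_abs,
      abs_of_nonneg ht0, abs_of_nonneg (sub_nonneg.2 ht1), hes]
    nlinarith
  have n2 : ‖1 - ((r : ℂ) * e) ^ 2‖ ≤ 2 * u := by
    have := upper (sq_nonneg r) (by nlinarith)
    rw [mul_pow, ← Complex.ofReal_pow]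
    nlinarith
  have n3 : ‖1 - (r : ℂ) * e * e‖ ≤ 2 * u := by
    have := upper hr0 hr1.le
    rw [mul_assoc, ← sq]
    linarith
  have n4 : u / 2 ≤ ‖1 - (r : ℂ) * e * e‖ := by
    -- The modulus in question is at least s by h1 and at least 1 - r by h2; averaging gives u/2.
    have h1 := norm_one_sub_le_two_mul he2.le ⟨hr0, hr1.le⟩
    have h2 := norm_sub_norm_le (1 : ℂ) (r * e ^ 2)
    rw [norm_mul, he2, norm_one, Complex.norm_real, Real.norm_eq_abs, abs_of_nonneg hr0] at h2
    rw [mul_assoc, ← sq]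
    linarith
  have n5 : r ^ k ≤ Real.exp (-(k * (1 - r))) := by
    have := Real.add_one_le_exp (-(1 - r))
    calc r ^ k ≤ (Real.exp (-(1 - r))) ^ k := pow_le_pow_left₀ hr0 (by linarith) k
      _ = _ := by rw [← Real.exp_nat_mul]; congr 1; ring
  rw [norm_discKernel, n0, n1]
  have m2 : ‖1 - ((r : ℂ) * e) ^ 2‖ ^ ν ≤ 2 ^ ν * u ^ ν := by
    rw [← Real.mul_rpow zero_le_two hu0.le]
    exact Real.rpow_le_rpow (norm_nonneg _) n2 hν
  have m3 := rpow_le_two_rpow_abs_mul (g := g) hu0 n4 n3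
  rw [Real.rpow_add hu0]
  calc _ ≤ Real.exp (-(k * (1 - r))) * (2 ^ ν * u ^ ν) * (2 ^ |g| * u ^ g * (1 - r) ^ g) := by
        gcongr
    _ = _ := by ring

/-! ### The kernel on the chord. -/

theorem chordPoint_one (c s : ℝ) : chordPoint c s 1 = c + s * Complex.I := by
  simp [chordPoint]; ring

theorem chordPoint_zero (c s : ℝ) : chordPoint c s 0 = c - s * Complex.I := by
  simp [chordPoint]; ring

theorem chordPoint_one_mul_zero {c s : ℝ} (h : c ^ 2 + s ^ 2 = 1) :
    chordPoint c s 1 * chordPoint c s 0 = 1 := by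
  have h' : (c : ℂ) ^ 2 + s ^ 2 = 1 := by exact_mod_cast h
  rw [chordPoint_one, chordPoint_zero]
  linear_combination h' - (s : ℂ) ^ 2 * Complex.I_sq

theorem norm_chordPoint_zero {c s : ℝ} (h : c ^ 2 + s ^ 2 = 1) : ‖chordPoint c s 0‖ = 1 := by
  refine (pow_eq_one_iff_of_nonneg (norm_nonneg _) two_ne_zero).1 ?_
  rw [normSq_chordPoint h]; ring

theorem norm_chordPoint_one {c s : ℝ} (h : c ^ 2 + s ^ 2 = 1) : ‖chordPoint c s 1‖ = 1 := by
  refine (pow_eq_one_iff_of_nonneg (norm_nonneg _) two_ne_zero).1 ?_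
  rw [normSq_chordPoint h]; ring

theorem norm_one_sub_chordPoint_one_sq {c s : ℝ} (h : c ^ 2 + s ^ 2 = 1) (hs : 0 < s) :
    ‖1 - chordPoint c s 1 ^ 2‖ = 2 * s := by
  have : 1 - chordPoint c s 1 ^ 2 = chordPoint c s 1 * (-(2 * s) * Complex.I) := by
    conv_lhs => rw [← chordPoint_one_mul_zero h]
    rw [chordPoint_one, chordPoint_zero]; ring
  rw [this, norm_mul, norm_chordPoint_one h]
  simp [abs_of_pos hs]

theorem norm_one_sub_chordPoint_zero_sq {c s : ℝ} (h : c ^ 2 + s ^ 2 = 1) (hs : 0 < s) :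
    ‖1 - chordPoint c s 0 ^ 2‖ = 2 * s := by
  have : 1 - chordPoint c s 0 ^ 2 = chordPoint c s 0 * (2 * s * Complex.I) := by
    conv_lhs => rw [← chordPoint_one_mul_zero h]
    rw [chordPoint_one, chordPoint_zero]; ring
  rw [this, norm_mul, norm_chordPoint_zero h]
  simp [abs_of_pos hs]

/-- Since 1 = ee', the left side is e'(e - z), and e - z points in a fixed direction along the
chord. The positive factor can therefore be pulled out of a complex power without changing branch.
-/
theorem one_sub_chordPoint_mul_zero {c s : ℝ} (h : c ^ 2 + s ^ 2 = 1) (x : ℝ) :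
    1 - chordPoint c s x * chordPoint c s 0 =
      ((2 * s * (1 - x) : ℝ) : ℂ) * (chordPoint c s 0 * Complex.I) := by
  conv_lhs => rw [← chordPoint_one_mul_zero h]
  simp only [chordPoint]
  push_cast
  ring

theorem one_sub_chordPoint_mul_one {c s : ℝ} (h : c ^ 2 + s ^ 2 = 1) (x : ℝ) :
    1 - chordPoint c s x * chordPoint c s 1 =
      ((2 * s * x : ℝ) : ℂ) * (chordPoint c s 1 * -Complex.I) := by
  conv_lhs => rw [← chordPoint_one_mul_zero h]
  simp only [chordPoint]
  push_cast
  ring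

theorem ofReal_mul_cpow_ofReal {r : ℝ} (hr : 0 < r) {a : ℂ} (ha : a ≠ 0) (g : ℝ) :
    ((r : ℂ) * a) ^ (g : ℂ) = ((r ^ g : ℝ) : ℂ) * a ^ (g : ℂ) := by
  have hr' : (r : ℂ) ≠ 0 := by exact_mod_cast hr.ne'
  rw [Complex.cpow_def_of_ne_zero (mul_ne_zero hr' ha), Complex.log_ofReal_mul hr ha, add_mul,
    Complex.exp_add, Complex.cpow_def_of_ne_zero ha, Complex.ofReal_cpow hr.le,
    Complex.cpow_def_of_ne_zero hr', Complex.ofReal_log hr.le]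

/-- On the chord, the disc kernel is the integrand of the fractional difference, up to a constant
of known modulus. -/
theorem exists_discKernel_chordPoint {g ν c s : ℝ} (h : c ^ 2 + s ^ 2 = 1) (hs : 0 < s) (k : ℕ) :
    ∃ κ : ℂ, ‖κ‖ = (4 * s ^ 2) ^ g ∧ ∀ x ∈ Set.Ioo (0 : ℝ) 1,
      discKernel g ν k (chordPoint c s 1) (chordPoint c s 0) (chordPoint c s x) =
        κ * ((chordPoint c s x ^ k * (1 - chordPoint c s x ^ 2) ^ (ν : ℂ)) *
          (((x * (1 - x)) ^ g : ℝ) : ℂ)) := by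
  have a0 : ‖chordPoint c s 0 * Complex.I‖ = 1 := by simp [norm_chordPoint_zero h]
  have a1 : ‖chordPoint c s 1 * -Complex.I‖ = 1 := by simp [norm_chordPoint_one h]
  refine ⟨(((4 * s ^ 2) ^ g : ℝ) : ℂ) * ((chordPoint c s 1 * -Complex.I) ^ (g : ℂ) *
    (chordPoint c s 0 * Complex.I) ^ (g : ℂ)), ?_, fun x hx => ?_⟩
  · rw [norm_mul, norm_mul, Complex.norm_cpow_real, Complex.norm_cpow_real, a0, a1,
      Real.one_rpow, mul_one, mul_one, Complex.norm_real, Real.norm_eq_abs, abs_of_pos]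
    positivity
  · have hx0 := hx.1
    have hx1 : 0 < 1 - x := sub_pos.2 hx.2
    rw [discKernel, one_sub_chordPoint_mul_one h, one_sub_chordPoint_mul_zero h,
      ofReal_mul_cpow_ofReal (by positivity) (norm_pos_iff.1 (by rw [a1]; exact one_pos)),
      ofReal_mul_cpow_ofReal (by positivity) (norm_pos_iff.1 (by rw [a0]; exact one_pos))]
    have : (2 * s * x) ^ g * (2 * s * (1 - x)) ^ g = (4 * s ^ 2) ^ g * (x * (1 - x)) ^ g := by
      rw [← Real.mul_rpow (by positivity) (by positivity),
        ← Real.mul_rpow (by positivity) (by positivity)]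
      congr 1
      ring
    have h2 := congrArg (fun t : ℝ => (t : ℂ)) this
    simp only [Complex.ofReal_mul] at h2
    linear_combination (chordPoint c s x ^ k * (1 - chordPoint c s x ^ 2) ^ (ν : ℂ) *
      ((chordPoint c s 1 * -Complex.I) ^ (g : ℂ) * (chordPoint c s 0 * Complex.I) ^ (g : ℂ))) * h2

/-- An integrable majorant independent of ρ: the first summand serves g ≥ 0, the second g ≤ 0, so
the sum covers both signs. -/
theorem norm_discKernel_mul_chordPoint_le {g ν c s ρ x : ℝ} (hν : 0 ≤ ν) (h : c ^ 2 + s ^ 2 = 1)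
    (hs : 0 < s) (k : ℕ) (hρ : ρ ∈ Set.Icc (0 : ℝ) 1) (hx : x ∈ Set.Ioo (0 : ℝ) 1) :
    ‖discKernel g ν k (chordPoint c s 1) (chordPoint c s 0) (ρ * chordPoint c s x)‖ ≤
      2 ^ ν * (2 ^ g * 2 ^ g + s ^ g * s ^ g * (x * (1 - x)) ^ g) := by
  have hx0 := hx.1
  have hx1 : 0 < 1 - x := sub_pos.2 hx.2
  have hz := norm_chordPoint_le_one h ⟨hx.1.le, hx.2.le⟩
  have hρz : ‖(ρ : ℂ) * chordPoint c s x‖ ≤ 1 := by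
    rw [norm_mul, Complex.norm_real, Real.norm_eq_abs, abs_of_nonneg hρ.1]
    exact mul_le_one₀ hρ.2 (norm_nonneg _) hz
  have le_two {w : ℂ} (hw : ‖w‖ ≤ 1) : ‖1 - w‖ ≤ 2 := by
    have := norm_sub_le (1 : ℂ) w
    rw [norm_one] at this
    linarith
  have b0 : ‖((ρ : ℂ) * chordPoint c s x) ^ k‖ * ‖1 - ((ρ : ℂ) * chordPoint c s x) ^ 2‖ ^ ν
      ≤ 2 ^ ν := by
    refine (mul_le_of_le_one_left (Real.rpow_nonneg (norm_nonneg _) _) ?_).trans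
      (Real.rpow_le_rpow (norm_nonneg _) (le_two ?_) hν)
    all_goals rw [norm_pow]; exact pow_le_one₀ (norm_nonneg _) hρz
  have w1 : ‖chordPoint c s x * chordPoint c s 1‖ ≤ 1 := by
    rwa [norm_mul, norm_chordPoint_one h, mul_one]
  have w0 : ‖chordPoint c s x * chordPoint c s 0‖ ≤ 1 := by
    rwa [norm_mul, norm_chordPoint_zero h, mul_one]
  have u1 : ‖1 - (ρ : ℂ) * chordPoint c s x * chordPoint c s 1‖ ≤ 2 :=
    le_two (by rwa [norm_mul, norm_chordPoint_one h, mul_one])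
  have u0 : ‖1 - (ρ : ℂ) * chordPoint c s x * chordPoint c s 0‖ ≤ 2 :=
    le_two (by rwa [norm_mul, norm_chordPoint_zero h, mul_one])
  have l1 : s * x ≤ ‖1 - (ρ : ℂ) * chordPoint c s x * chordPoint c s 1‖ := by
    have := norm_one_sub_le_two_mul w1 hρ
    rw [one_sub_chordPoint_mul_one h, norm_mul _ (_ * _), norm_mul _ (-_), norm_neg,
      Complex.norm_I, norm_chordPoint_one h, Complex.norm_real, Real.norm_eq_abs,
      abs_of_pos (by positivity), ← mul_assoc (ρ : ℂ)] at this
    linarith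
  have l0 : s * (1 - x) ≤ ‖1 - (ρ : ℂ) * chordPoint c s x * chordPoint c s 0‖ := by
    have := norm_one_sub_le_two_mul w0 hρ
    rw [one_sub_chordPoint_mul_zero h, norm_mul _ (_ * _), norm_mul _ Complex.I,
      Complex.norm_I, norm_chordPoint_zero h, Complex.norm_real, Real.norm_eq_abs,
      abs_of_pos (by positivity), ← mul_assoc (ρ : ℂ)] at this
    linarith
  rw [norm_discKernel, ← norm_pow]
  refine mul_le_mul b0 ?_ (by positivity) (by positivity)
  rcases le_total 0 g with hg | hg
  · refine le_add_of_le_of_nonneg ?_ (by positivity)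
    exact mul_le_mul (Real.rpow_le_rpow (norm_nonneg _) u1 hg)
      (Real.rpow_le_rpow (norm_nonneg _) u0 hg) (by positivity) (by positivity)
  · refine le_add_of_nonneg_of_le (by positivity) ?_
    have : s ^ g * s ^ g * (x * (1 - x)) ^ g = (s * x) ^ g * (s * (1 - x)) ^ g := by
      rw [Real.mul_rpow hs.le hx0.le, Real.mul_rpow hs.le hx1.le, Real.mul_rpow hx0.le hx1.le]
      ring
    rw [this]
    exact mul_le_mul (Real.rpow_le_rpow_of_nonpos (by positivity) l1 hg)
      (Real.rpow_le_rpow_of_nonpos (by positivity) l0 hg) (by positivity) (by positivity)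

/-! ### Moving the contour from the chord to the radii. -/

-- The chord's endpoints lie on the unit circle, outside the open disc where holomorphy is
-- available. Cauchy's theorem is applied to the chord scaled by ρ < 1, and this limit recovers the
-- original one.
open MeasureTheory Set Filter Topology in
theorem tendsto_integral_discKernel {g ν c s : ℝ} (hg : -1 < g) (hν : 0 ≤ ν)
    (h : c ^ 2 + s ^ 2 = 1) (hs : 0 < s) (k : ℕ) :
    Tendsto (fun ρ : ℝ => ∫ x in (0 : ℝ)..1,
        discKernel g ν k (chordPoint c s 1) (chordPoint c s 0) (ρ * chordPoint c s x)) (𝓝[<] 1)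
      (𝓝 (∫ x in (0 : ℝ)..1,
        discKernel g ν k (chordPoint c s 1) (chordPoint c s 0) (chordPoint c s x))) := by
  have hdiff := differentiableOn_discKernel g ν k (norm_chordPoint_one h) (norm_chordPoint_zero h)
  have hρ : ∀ᶠ ρ : ℝ in 𝓝[<] 1, ρ ∈ Ioo (0 : ℝ) 1 := Ioo_mem_nhdsLT zero_lt_one
  have hx1 : ∀ᵐ x : ℝ, x ≠ 1 := by simp [ae_iff]
  refine intervalIntegral.tendsto_integral_filter_of_dominated_convergence
    (fun x => 2 ^ ν * (2 ^ g * 2 ^ g + s ^ g * s ^ g * (x * (1 - x)) ^ g)) ?_ ?_ ?_ ?_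
  · filter_upwards [hρ] with ρ hρ
    rw [uIoc_of_le zero_le_one]
    refine ContinuousOn.aestronglyMeasurable ?_ measurableSet_Ioc
    refine hdiff.continuousOn.comp (t := Metric.ball 0 1) (by fun_prop) fun x hx => ?_
    rw [mem_ball_zero_iff, norm_mul, Complex.norm_real, Real.norm_eq_abs, abs_of_pos hρ.1]
    exact (mul_le_of_le_one_right hρ.1.le
      (norm_chordPoint_le_one h ⟨hx.1.le, hx.2⟩)).trans_lt hρ.2
  · filter_upwards [hρ] with ρ hρ
    filter_upwards [hx1] with x hx1 hx
    rw [uIoc_of_le zero_le_one] at hx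
    exact norm_discKernel_mul_chordPoint_le hν h hs k ⟨hρ.1.le, hρ.2.le⟩
      ⟨hx.1, lt_of_le_of_ne hx.2 hx1⟩
  · exact (intervalIntegrable_const.add
      ((intervalIntegrable_rpow_mul_one_sub g hg).const_mul _)).const_mul _
  · filter_upwards [hx1] with x hx1 hx
    rw [uIoc_of_le zero_le_one] at hx
    have hz := norm_chordPoint_lt_one h hs ⟨hx.1, lt_of_le_of_ne hx.2 hx1⟩
    have hcont := (hdiff.differentiableAt
      (Metric.isOpen_ball.mem_nhds (mem_ball_zero_iff.2 hz))).continuousAt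
    have ht : Tendsto (fun ρ : ℝ => (ρ : ℂ) * chordPoint c s x) (𝓝[<] 1)
        (𝓝 (chordPoint c s x)) := by
      have : Continuous fun ρ : ℝ => (ρ : ℂ) * chordPoint c s x := by fun_prop
      have := (this.tendsto 1).mono_left (nhdsWithin_le_nhds (s := Iio 1))
      simpa using this
    exact hcont.tendsto.comp ht

open MeasureTheory Set in
/-- Cauchy's theorem for the triangle with vertices `0`, `ρ e^{-iθ}`, `ρ e^{iθ}`. -/
theorem integral_chord_eq_sub_integral_radial {c s ρ : ℝ} (h : c ^ 2 + s ^ 2 = 1)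
    (hρ : ρ ∈ Ioo (0 : ℝ) 1) {F : ℂ → ℂ} (hF : DifferentiableOn ℂ F (Metric.ball 0 1)) :
    (∫ x in (0 : ℝ)..1, F (ρ * chordPoint c s x)) * (ρ * (2 * s * Complex.I)) =
      (∫ r in (0 : ℝ)..ρ, F (r * chordPoint c s 1)) * chordPoint c s 1 -
      (∫ r in (0 : ℝ)..ρ, F (r * chordPoint c s 0)) * chordPoint c s 0 := by
  -- With a primitive G on the disc, all three integrals become differences of values of G, and G 0
  -- cancels.
  obtain ⟨G, hG⟩ := hF.isExactOn_ball
  have mem_chord {x : ℝ} (hx : x ∈ Icc (0 : ℝ) 1) :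
      (ρ : ℂ) * chordPoint c s x ∈ Metric.ball (0 : ℂ) 1 := by
    rw [mem_ball_zero_iff, norm_mul, Complex.norm_real, Real.norm_eq_abs, abs_of_pos hρ.1]
    exact (mul_le_of_le_one_right hρ.1.le (norm_chordPoint_le_one h hx)).trans_lt hρ.2
  have mem_radial {e : ℂ} (he : ‖e‖ = 1) {r : ℝ} (hr : r ∈ Icc 0 ρ) :
      (r : ℂ) * e ∈ Metric.ball (0 : ℂ) 1 := by
    rw [mem_ball_zero_iff, norm_mul, Complex.norm_real, Real.norm_eq_abs, abs_of_nonneg hr.1, he,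
      mul_one]
    exact hr.2.trans_lt hρ.2
  have chord : (∫ x in (0 : ℝ)..1, F (ρ * chordPoint c s x) * (ρ * (2 * s * Complex.I))) =
      G (ρ * chordPoint c s 1) - G (ρ * chordPoint c s 0) := by
    refine intervalIntegral.integral_eq_sub_of_hasDerivAt
      (f := fun x : ℝ => G (ρ * chordPoint c s x)) (fun x hx => ?_)
      (ContinuousOn.intervalIntegrable ?_)
    · rw [uIcc_of_le zero_le_one] at hx
      exact (hG _ (mem_chord hx)).comp x ((hasDerivAt_chordPoint c s x).const_mul (ρ : ℂ))
    · rw [uIcc_of_le zero_le_one]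
      exact (hF.continuousOn.comp (by fun_prop) fun x hx => mem_chord hx).mul continuousOn_const
  have radial {e : ℂ} (he : ‖e‖ = 1) :
      (∫ r in (0 : ℝ)..ρ, F (r * e) * e) = G (ρ * e) - G 0 := by
    have := intervalIntegral.integral_eq_sub_of_hasDerivAt (a := 0) (b := ρ)
      (f := fun r : ℝ => G (r * e)) (f' := fun r : ℝ => F (r * e) * e) (fun r hr => ?_)
      (ContinuousOn.intervalIntegrable ?_)
    · simpa using this
    · rw [uIcc_of_le hρ.1.le] at hr
      have d : HasDerivAt (fun r : ℝ => (r : ℂ) * e) e r := by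
        simpa using ((hasDerivAt_id r).ofReal_comp).mul_const e
      exact (hG _ (mem_radial he hr)).comp r d
    · rw [uIcc_of_le hρ.1.le]
      exact (hF.continuousOn.comp (by fun_prop) fun r hr => mem_radial he hr).mul
        continuousOn_const
  rw [← intervalIntegral.integral_mul_const, ← intervalIntegral.integral_mul_const,
    ← intervalIntegral.integral_mul_const, chord, radial (norm_chordPoint_one h),
    radial (norm_chordPoint_zero h)]
  ring

/-! ### The radial integral and the resulting chord estimate. -/

open MeasureTheory Set in
theorem integrableOn_rpow_mul_exp_neg_mul {p b : ℝ} (hp : 0 < p) (hb : 0 < b) :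
    IntegrableOn (fun x : ℝ => x ^ (p - 1) * Real.exp (-(b * x))) (Ioi 0) := by
  have := integrableOn_rpow_mul_exp_neg_mul_rpow (s := p - 1) (p := 1) (b := b) (by linarith)
    one_pos hb
  simpa [neg_mul] using this

/-- The constant in `integral_radial_le`. -/
noncomputable def radialConst (g q : ℝ) : ℝ :=
  2 ^ max q 0 * (Real.Gamma (g + 1 + max q 0) + Real.Gamma (g + 1))

/-- For q ≥ 0 the larger of x and s dominates; for q ≤ 0 simply (x+s)^q ≤ s^q. The exponent max q 0
treats both signs at once. -/
theorem add_rpow_le_two_rpow_mul {x s q : ℝ} (hx : 0 < x) (hs : 0 < s) :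
    (x + s) ^ q ≤ 2 ^ max q 0 * (s ^ (q - max q 0) * x ^ max q 0 + s ^ q) := by
  rcases le_total 0 q with hq | hq
  · rw [max_eq_left hq, sub_self, Real.rpow_zero, one_mul]
    rcases le_total x s with h | h
    · have : (x + s) ^ q ≤ 2 ^ q * s ^ q := by
        rw [← Real.mul_rpow zero_le_two hs.le]
        exact Real.rpow_le_rpow (by positivity) (by linarith) hq
      refine this.trans (mul_le_mul_of_nonneg_left ?_ (by positivity))
      exact le_add_of_nonneg_left (by positivity)
    · have : (x + s) ^ q ≤ 2 ^ q * x ^ q := by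
        rw [← Real.mul_rpow zero_le_two hx.le]
        exact Real.rpow_le_rpow (by positivity) (by linarith) hq
      refine this.trans (mul_le_mul_of_nonneg_left ?_ (by positivity))
      exact le_add_of_nonneg_right (by positivity)
  · rw [max_eq_right hq, sub_zero, Real.rpow_zero, Real.rpow_zero, one_mul, mul_one]
    refine (Real.rpow_le_rpow_of_nonpos hs (by linarith) hq).trans ?_
    exact le_add_of_nonneg_left (by positivity)

-- Substituting x = 1 - r and extending to the half-line leaves two Gamma integrals. Their sizes
-- differ by the factor (bs)^(-max q 0), which is at most 1 because bs ≥ 1.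
open MeasureTheory Set in
theorem integral_radial_le {g q s b ρ : ℝ} (hg : -1 < g) (hs : 0 < s) (hb : 0 < b)
    (hbs : 1 ≤ b * s) (hρ : ρ ∈ Ioo (0 : ℝ) 1) :
    ∫ r in (0 : ℝ)..ρ, (1 - r) ^ g * ((1 - r) + s) ^ q * Real.exp (-(b * (1 - r))) ≤
      radialConst g q * (s ^ q * b ^ (-(g + 1))) := by
  set Q := max q 0 with hQ
  have hQ0 : 0 ≤ Q := le_max_right _ _
  set p : ℝ → ℝ := fun x => 2 ^ Q * (s ^ (q - Q) * (x ^ (g + 1 + Q - 1) * Real.exp (-(b * x))) +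
    s ^ q * (x ^ (g + 1 - 1) * Real.exp (-(b * x)))) with hp
  have i1 := integrableOn_rpow_mul_exp_neg_mul (p := g + 1 + Q) (by linarith) hb
  have i2 := integrableOn_rpow_mul_exp_neg_mul (p := g + 1) (by linarith) hb
  have hpi : IntegrableOn p (Ioi 0) :=
    ((i1.const_mul (s ^ (q - Q))).add (i2.const_mul (s ^ q))).const_mul _
  have hρ1 : 0 < 1 - ρ := sub_pos.2 hρ.2
  have hρ1' : 1 - ρ ≤ 1 := by linarith [hρ.1]
  have sub : Ioc (1 - ρ) 1 ⊆ Ioi (0 : ℝ) := fun x hx => hρ1.trans hx.1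
  have hle : ∀ x ∈ Ioi (0 : ℝ), x ^ g * (x + s) ^ q * Real.exp (-(b * x)) ≤ p x := by
    intro x hx
    have hx' : 0 < x := hx
    have e1 : x ^ (g + 1 + Q - 1) = x ^ g * x ^ Q := by
      rw [← Real.rpow_add hx']; congr 1; ring
    simp only [hp]
    rw [e1, add_sub_cancel_right]
    calc _ ≤ x ^ g * (2 ^ Q * (s ^ (q - Q) * x ^ Q + s ^ q)) * Real.exp (-(b * x)) := by
          gcongr
          exact add_rpow_le_two_rpow_mul hx' hs
      _ = _ := by ring
  have hp0 : ∀ x ∈ Ioi (0 : ℝ), 0 ≤ p x := fun x hx => by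
    have hx' : 0 < x := hx
    positivity
  rw [intervalIntegral.integral_comp_sub_left
    (fun x => x ^ g * (x + s) ^ q * Real.exp (-(b * x))), sub_zero]
  have step1 : ∫ x in (1 - ρ)..1, x ^ g * (x + s) ^ q * Real.exp (-(b * x)) ≤
      ∫ x in Ioi (0 : ℝ), p x := by
    rw [intervalIntegral.integral_of_le hρ1']
    refine (setIntegral_mono_on ?_ (hpi.mono_set sub) measurableSet_Ioc
      fun x hx => hle x (sub hx)).trans ?_
    · have : ContinuousOn (fun x : ℝ => x ^ g * (x + s) ^ q * Real.exp (-(b * x)))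
          (Icc (1 - ρ) 1) := by
        have hpos : ∀ x ∈ Icc (1 - ρ) 1, 0 < x := fun x hx => hρ1.trans_le hx.1
        refine ContinuousOn.mul (ContinuousOn.mul ?_ ?_) (by fun_prop)
        · exact continuousOn_id.rpow_const fun x hx => Or.inl (hpos x hx).ne'
        · exact ContinuousOn.rpow_const (by fun_prop) fun x hx =>
            Or.inl (add_pos (hpos x hx) hs).ne'
      exact this.integrableOn_Icc.mono_set Ioc_subset_Icc_self
    · exact setIntegral_mono_set hpi ((ae_restrict_iff' measurableSet_Ioi).2
        (Filter.Eventually.of_forall hp0)) sub.eventuallyLE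
  refine step1.trans ?_
  have step2 : ∫ x in Ioi (0 : ℝ), p x = 2 ^ Q * (s ^ (q - Q) *
      ((1 / b) ^ (g + 1 + Q) * Real.Gamma (g + 1 + Q)) +
      s ^ q * ((1 / b) ^ (g + 1) * Real.Gamma (g + 1))) := by
    simp only [hp]
    rw [integral_const_mul, integral_add (i1.const_mul _) (i2.const_mul _), integral_const_mul,
      integral_const_mul, Real.integral_rpow_mul_exp_neg_mul_Ioi (by linarith) hb,
      Real.integral_rpow_mul_exp_neg_mul_Ioi (by linarith) hb]
  rw [step2, radialConst, ← hQ]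
  have hb1 : (1 / b) ^ (g + 1) = b ^ (-(g + 1)) := by
    rw [one_div, Real.inv_rpow hb.le, Real.rpow_neg hb.le]
  have hb2 : s ^ (q - Q) * (1 / b) ^ (g + 1 + Q) ≤ s ^ q * b ^ (-(g + 1)) := by
    have h1 : 1 ≤ (b * s) ^ Q := Real.one_le_rpow hbs hQ0
    rw [Real.mul_rpow hb.le hs.le] at h1
    rw [Real.rpow_add (by positivity), hb1, one_div, Real.inv_rpow hb.le, Real.rpow_sub hs]
    rw [show s ^ q / s ^ Q * (b ^ (-(g + 1)) * (b ^ Q)⁻¹) =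
      s ^ q * b ^ (-(g + 1)) / (b ^ Q * s ^ Q) by field_simp]
    exact div_le_self (by positivity) h1
  have G1 : 0 < Real.Gamma (g + 1 + Q) := Real.Gamma_pos_of_pos (by linarith)
  rw [hb1]
  calc _ = 2 ^ Q * ((s ^ (q - Q) * (1 / b) ^ (g + 1 + Q)) * Real.Gamma (g + 1 + Q) +
        s ^ q * b ^ (-(g + 1)) * Real.Gamma (g + 1)) := by ring
    _ ≤ 2 ^ Q * ((s ^ q * b ^ (-(g + 1))) * Real.Gamma (g + 1 + Q) +
        s ^ q * b ^ (-(g + 1)) * Real.Gamma (g + 1)) := by gcongr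
    _ = _ := by ring

open MeasureTheory Set in
theorem norm_integral_discKernel_radial_le {g ν s ρ : ℝ} (hg : -1 < g) (hν : 0 ≤ ν) (hs : 0 < s)
    {k : ℕ} (hk : 0 < k) (hks : 1 ≤ k * s) {e e' : ℂ} (he : ‖e‖ = 1) (hee : e * e' = 1)
    (hes : ‖1 - e ^ 2‖ = 2 * s) (hρ : ρ ∈ Ioo (0 : ℝ) 1) :
    ‖∫ r in (0 : ℝ)..ρ, discKernel g ν k e e' (r * e)‖ ≤
      2 ^ ν * 2 ^ |g| * (radialConst g (ν + g) * (s ^ (ν + g) * (k : ℝ) ^ (-(g + 1)))) := by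
  refine (intervalIntegral.norm_integral_le_of_norm_le hρ.1.le
    (g := fun r => 2 ^ ν * 2 ^ |g| *
      ((1 - r) ^ g * ((1 - r) + s) ^ (ν + g) * Real.exp (-(k * (1 - r)))))
    (Filter.Eventually.of_forall fun r hr => norm_discKernel_radial_le hν hs k he hee hes hr.1.le
      (hr.2.trans_lt hρ.2)) (ContinuousOn.intervalIntegrable ?_)).trans ?_
  · rw [uIcc_of_le hρ.1.le]
    have hpos : ∀ x ∈ Icc 0 ρ, 0 < 1 - x := fun x hx => sub_pos.2 (hx.2.trans_lt hρ.2)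
    refine continuousOn_const.mul (ContinuousOn.mul (ContinuousOn.mul ?_ ?_) (by fun_prop))
    · exact ContinuousOn.rpow_const (by fun_prop) fun x hx => Or.inl (hpos x hx).ne'
    · exact ContinuousOn.rpow_const (by fun_prop) fun x hx => Or.inl (add_pos (hpos x hx) hs).ne'
  · rw [intervalIntegral.integral_const_mul]
    exact mul_le_mul_of_nonneg_left
      (integral_radial_le hg hs (Nat.cast_pos.2 hk) hks hρ) (by positivity)

open MeasureTheory Set Filter Topology in
theorem norm_integral_discKernel_chord_le {g ν c s : ℝ} (hg : -1 < g) (hν : 0 ≤ ν)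
    (h : c ^ 2 + s ^ 2 = 1) (hs : 0 < s) {k : ℕ} (hk : 0 < k) (hks : 1 ≤ k * s) :
    ‖∫ x in (0 : ℝ)..1,
        discKernel g ν k (chordPoint c s 1) (chordPoint c s 0) (chordPoint c s x)‖ * s ≤
      2 ^ ν * 2 ^ |g| * (radialConst g (ν + g) * (s ^ (ν + g) * (k : ℝ) ^ (-(g + 1)))) := by
  set M := 2 ^ ν * 2 ^ |g| * (radialConst g (ν + g) * (s ^ (ν + g) * (k : ℝ) ^ (-(g + 1))))
  have ht := ((tendsto_integral_discKernel hg hν h hs k).norm).mul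
    (tendsto_id.mono_left (nhdsWithin_le_nhds (a := (1 : ℝ)) (s := Iio 1)))
  have hlim := ht.mul_const s
  simp only [id, mul_one] at hlim
  refine le_of_tendsto hlim ?_
  have hρ : ∀ᶠ ρ : ℝ in 𝓝[<] 1, ρ ∈ Ioo (0 : ℝ) 1 := Ioo_mem_nhdsLT zero_lt_one
  filter_upwards [hρ] with ρ hρ
  have key := congrArg norm (integral_chord_eq_sub_integral_radial h hρ
    (differentiableOn_discKernel g ν k (norm_chordPoint_one h) (norm_chordPoint_zero h)))
  have b1 := norm_integral_discKernel_radial_le hg hν hs hk hks (norm_chordPoint_one h)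
    (chordPoint_one_mul_zero h) (norm_one_sub_chordPoint_one_sq h hs) hρ
  have b0 := norm_integral_discKernel_radial_le hg hν hs hk hks (norm_chordPoint_zero h)
    ((mul_comm _ _).trans (chordPoint_one_mul_zero h)) (norm_one_sub_chordPoint_zero_sq h hs) hρ
  simp only [discKernel_comm g ν k (chordPoint c s 0)] at b0
  have hr := norm_sub_le
    ((∫ r in (0 : ℝ)..ρ, discKernel g ν k (chordPoint c s 1) (chordPoint c s 0)
      (r * chordPoint c s 1)) * chordPoint c s 1)
    ((∫ r in (0 : ℝ)..ρ, discKernel g ν k (chordPoint c s 1) (chordPoint c s 0)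
      (r * chordPoint c s 0)) * chordPoint c s 0)
  rw [← key, norm_mul, norm_mul _ (chordPoint c s 1), norm_mul _ (chordPoint c s 0),
    norm_chordPoint_one h, norm_chordPoint_zero h, mul_one, mul_one] at hr
  -- The 2 from the chord's velocity cancels against the two radial contributions.
  have e : ‖(ρ : ℂ) * (2 * s * Complex.I)‖ = 2 * (ρ * s) := by
    simp [abs_of_pos hρ.1, abs_of_pos hs]; ring
  rw [e] at hr
  linarith

/-! ### The decay estimate and the conclusion. -/

/-- The decay estimate in the range `1 ≤ k sin θ`. -/
theorem abs_fracDiff_jacobiR_le_of_one_le {a c s ν : ℝ} (ha : -(1 / 2) < a) (hν : 0 < ν)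
    (h : c ^ 2 + s ^ 2 = 1) (hs : 0 < s) {k : ℕ} (hk : 0 < k) (hks : 1 ≤ k * s) :
    |fracDiff 2 ν (fun n => jacobiR a a n c) k| *
        ∫ x in (0 : ℝ)..1, (x * (1 - x)) ^ (a - 1 / 2) ≤
      2 ^ ν * 2 ^ |a - 1 / 2| * radialConst (a - 1 / 2) (ν + (a - 1 / 2)) * 4 ^ (-(a - 1 / 2)) *
        (s ^ (ν - a - 1 / 2) * (k : ℝ) ^ (-a - 1 / 2)) := by
  have hg : -1 < a - 1 / 2 := by linarith
  have hpos := integral_rpow_mul_one_sub_pos hg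
  have h1 := congrArg norm (fracDiff_jacobiR_mul_integral ha hν h hs k)
  rw [chordMoment_zero, norm_mul, Complex.norm_real, Complex.norm_real, Real.norm_eq_abs,
    Real.norm_eq_abs, abs_of_pos hpos] at h1
  rw [h1]
  have h2 := norm_integral_discKernel_chord_le hg hν.le h hs hk hks
  obtain ⟨κ, hκ, hκF⟩ := exists_discKernel_chordPoint (g := a - 1 / 2) (ν := ν) h hs k
  have h3 : ∫ x in (0 : ℝ)..1, discKernel (a - 1 / 2) ν k (chordPoint c s 1) (chordPoint c s 0)
      (chordPoint c s x) = κ * ∫ x in (0 : ℝ)..1,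
        (chordPoint c s x ^ k * (1 - chordPoint c s x ^ 2) ^ (ν : ℂ)) *
        (((x * (1 - x)) ^ (a - 1 / 2) : ℝ) : ℂ) := by
    rw [← intervalIntegral.integral_const_mul]
    refine intervalIntegral.integral_congr_ae ?_
    have hx1 : ∀ᵐ x : ℝ, x ≠ 1 := by simp [MeasureTheory.ae_iff]
    filter_upwards [hx1] with x hx1 hx
    rw [Set.uIoc_of_le zero_le_one] at hx
    exact hκF x ⟨hx.1, lt_of_le_of_ne hx.2 hx1⟩
  rw [h3, norm_mul, hκ] at h2
  generalize ‖∫ x in (0 : ℝ)..1, (chordPoint c s x ^ k * (1 - chordPoint c s x ^ 2) ^ (ν : ℂ)) *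
        (((x * (1 - x)) ^ (a - 1 / 2) : ℝ) : ℂ)‖ = J at h2 ⊢
  have h4 : 0 < (4 * s ^ 2) ^ (a - 1 / 2) * s := by positivity
  -- Dividing out |κ|·s lowers the exponent of s by 2(a - 1/2) + 1, from ν + a - 1/2 to ν - a - 1/2.
  have e1 : s ^ (ν + (a - 1 / 2)) =
      4 ^ (-(a - 1 / 2)) * s ^ (ν - a - 1 / 2) * ((4 * s ^ 2) ^ (a - 1 / 2) * s) := by
    have e2 : (s ^ 2) ^ (a - 1 / 2) = s ^ (2 * (a - 1 / 2)) := by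
      rw [← Real.rpow_natCast_mul hs.le]
      norm_num
    rw [Real.mul_rpow (by norm_num) (by positivity), e2]
    have e3 : (4 : ℝ) ^ (-(a - 1 / 2)) * 4 ^ (a - 1 / 2) = 1 := by
      rw [← Real.rpow_add (by norm_num)]; simp
    have e4 : s ^ (ν - a - 1 / 2) * (s ^ (2 * (a - 1 / 2)) * s) = s ^ (ν + (a - 1 / 2)) := by
      rw [← Real.rpow_add_one hs.ne', ← Real.rpow_add hs]
      congr 1
      ring
    rw [← e4]
    linear_combination (-(s ^ (ν - a - 1 / 2) * (s ^ (2 * (a - 1 / 2)) * s))) * e3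
  refine le_of_mul_le_mul_right ?_ h4
  rw [e1, show -(a - 1 / 2 + 1) = -a - 1 / 2 by ring] at h2
  linarith

theorem lemma4p5 (α ν : ℝ) (hα : -(1 / 2) < α) (hν0 : 0 < ν) (hν : ν < α + 1 / 2) :
    (∀ (k : ℕ) (θ : ℝ), 0 < θ → θ < Real.pi / 2 →
      Summable (fracDiffTerm 2 ν (fun n => jacobiR α α n (Real.cos θ)) k)) ∧
    (∃ K : ℝ, ∀ (k : ℕ) (θ : ℝ), 0 < θ → θ < Real.pi / 2 →
      |fracDiff 2 ν (fun n => jacobiR α α n (Real.cos θ)) k| ≤ K * Real.sin θ ^ ν) ∧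
    ((1 / 2 < α → (greatestIntLT (α + 1 / 2) : ℝ) ≤ ν) →
      ∃ K : ℝ, ∀ (k : ℕ) (θ : ℝ), 0 < θ → θ < Real.pi / 2 →
        |fracDiff 2 ν (fun n => jacobiR α α n (Real.cos θ)) k| ≤
          K * Real.sin θ ^ (ν - α - 1 / 2) * ((k : ℝ) + 1) ^ (-α - 1 / 2)) := by
  have hsin {θ : ℝ} (h0 : 0 < θ) (h1 : θ < Real.pi / 2) : 0 < Real.sin θ :=
    Real.sin_pos_of_pos_of_lt_pi h0 (by linarith [Real.pi_pos])
  refine ⟨fun k θ _ _ => summable_fracDiffTerm_jacobiR hα hν0 (Real.cos_sq_add_sin_sq θ) k,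
    ⟨4 ^ ν, fun k θ h0 h1 => abs_fracDiff_jacobiR_le hα hν0 (Real.cos_sq_add_sin_sq θ)
      (hsin h0 h1) k⟩, fun _ => ?_⟩
  have hpos := integral_rpow_mul_one_sub_pos (g := α - 1 / 2) (by linarith)
  set B := ∫ x in (0 : ℝ)..1, (x * (1 - x)) ^ (α - 1 / 2) with hB
  set D := 2 ^ ν * 2 ^ |α - 1 / 2| * radialConst (α - 1 / 2) (ν + (α - 1 / 2)) *
    4 ^ (-(α - 1 / 2)) with hD
  have hD0 : 0 ≤ D := by
    have g1 : 0 < Real.Gamma (α - 1 / 2 + 1) := Real.Gamma_pos_of_pos (by linarith)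
    have g2 : 0 < Real.Gamma (α - 1 / 2 + 1 + max (ν + (α - 1 / 2)) 0) :=
      Real.Gamma_pos_of_pos (by linarith [le_max_right (ν + (α - 1 / 2)) 0])
    rw [hD, radialConst]
    positivity
  have hα2 : 0 < α + 1 / 2 := by linarith
  -- The first summand serves ks < 1 and the second ks ≥ 1; both factors 2^(α+1/2) pay for having
  -- k+1 in place of k.
  refine ⟨4 ^ ν * 2 ^ (α + 1 / 2) + D / B * 2 ^ (α + 1 / 2), fun k θ h0 h1 => ?_⟩
  have hs := hsin h0 h1
  have hcs := Real.cos_sq_add_sin_sq θ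
  have hs1 := Real.sin_le_one θ
  generalize Real.sin θ = s at *
  generalize Real.cos θ = c at *
  have hk0 : (0 : ℝ) ≤ k := k.cast_nonneg
  have hk1 : (0 : ℝ) < (k : ℝ) + 1 := by positivity
  rw [show -α - 1 / 2 = -(α + 1 / 2) by ring, mul_assoc, add_mul]
  rcases le_or_gt 1 (k * s) with hks | hks
  · refine le_add_of_nonneg_of_le (by positivity) ?_
    have hk : 0 < k := by
      rcases Nat.eq_zero_or_pos k with rfl | hk
      · norm_num at hks
      · exact hk
    have hkr : (1 : ℝ) ≤ k := by exact_mod_cast hk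
    have key := abs_fracDiff_jacobiR_le_of_one_le hα hν0 hcs hs hk hks
    rw [← hB, ← hD, ← le_div_iff₀ hpos, show -α - 1 / 2 = -(α + 1 / 2) by ring] at key
    have hkk : (k : ℝ) ^ (-(α + 1 / 2)) ≤ 2 ^ (α + 1 / 2) * ((k : ℝ) + 1) ^ (-(α + 1 / 2)) := by
      have e : (2 : ℝ) ^ (α + 1 / 2) * ((k : ℝ) + 1) ^ (-(α + 1 / 2)) =
          (((k : ℝ) + 1) / 2) ^ (-(α + 1 / 2)) := by
        rw [Real.div_rpow hk1.le zero_le_two, Real.rpow_neg zero_le_two, div_inv_eq_mul, mul_comm]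
      rw [e]
      exact Real.rpow_le_rpow_of_nonpos (by positivity) (by linarith) (by linarith)
    calc _ ≤ D * (s ^ (ν - α - 1 / 2) * (k : ℝ) ^ (-(α + 1 / 2))) / B := key
      _ ≤ D * (s ^ (ν - α - 1 / 2) * (2 ^ (α + 1 / 2) * ((k : ℝ) + 1) ^ (-(α + 1 / 2)))) / B := by
        gcongr
      _ = _ := by ring
  · refine le_add_of_le_of_nonneg ?_ (by positivity)
    refine (abs_fracDiff_jacobiR_le hα hν0 hcs hs k).trans ?_
    rw [mul_assoc]
    refine mul_le_mul_of_nonneg_left ?_ (by positivity)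
    have e1 : s ^ ν = s ^ (ν - α - 1 / 2) * s ^ (α + 1 / 2) := by
      rw [← Real.rpow_add hs]; congr 1; ring
    -- From ks < 1 and s ≤ 1 one gets s(k+1) ≤ 2, which trades powers of s for decay in k.
    have e2 : s ^ (α + 1 / 2) ≤ 2 ^ (α + 1 / 2) * ((k : ℝ) + 1) ^ (-(α + 1 / 2)) := by
      rw [Real.rpow_neg hk1.le, ← div_eq_mul_inv, ← Real.div_rpow zero_le_two hk1.le]
      refine Real.rpow_le_rpow hs.le ?_ hα2.le
      rw [le_div_iff₀ hk1]
      nlinarith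
    rw [e1]
    calc _ ≤ s ^ (ν - α - 1 / 2) * (2 ^ (α + 1 / 2) * ((k : ℝ) + 1) ^ (-(α + 1 / 2))) := by
          gcongr
      _ = _ := by ring
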